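/- **Theorem 1 (Extreme value theorem for geometric Brownian motion).** Let $\mu,\sigma>0$ and $B>1$ be real constants. There exist constants $C>0$ and $T_0>0$, depending only on $\mu,\sigma,B$, such that the following holds. Let $(\Omega,\mathcal F,\mathbb P)$ be a probability space with a filtration $(\mathcal F_t)_{t\ge 0}$, let $W$ be a standard one-dimensional Brownian motion relative to $(\mathcal F_t)$ (adapted, with $W_t-W_s$ independent of $\mathcal F_s$ for $s\le t$), and let $X$ be a continuous adapted solution of the Itô stochastic differential equation $$dX_t=\mu X_t\,dt+\sigma X_t\,dW_t,\qquad X_0=1 .$$ For $T>0$ let $A_T=\{\max_{0\le t\le T}X_t\ge B\}$. Then for every $0<T<T_0$ one has $\mathbb P(A_T)>0$, and, with $\mathbb P_T(E)=\mathbb P(E\cap A_T)/\mathbb P(A_T)$ for events $E$ and $\mathbb E_{\mathbb P_T}$ the expectation under $\mathbb P_T$, the random variable $\sup_{0\le t\le T}|X_t-B^{t/T}|$ is $\mathbb P_T$-integrable and $$\mathbb E_{\mathbb P_T}\Big[\sup_{0\le t\le T}\big|X_t-B^{t/T}\big|\Big]\le C\sqrt T .$$ In other words, this conditional expectation is $O(\sqrt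 T)$ as $T\to0^+$, with implied constants depending only on $\mu,\sigma,B$. -/

import Mathlib

open MeasureTheory ProbabilityTheory Filter Topology
open scoped NNReal ENNReal

/-- `W` is a standard one-dimensional Brownian motion relative to the filtration `𝓕`: it is a
Brownian motion, it is adapted, and its increments after time `s` are independent of `𝓕 s`. -/
structure IsBrownianWrt {Ω : Type*} {mΩ : MeasurableSpace Ω} (𝓕 : Filtration ℝ≥0 mΩ)
    (W : ℝ≥0 → Ω → ℝ) (P : Measure Ω) : Prop where
  isBrownian : IsBrownianReal W P
  adapted : Adapted 𝓕 W
  indep : ∀ s t : ℝ≥0, s ≤ t →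
    Indep (MeasurableSpace.comap (fun ω ↦ W t ω - W s ω) inferInstance) (𝓕 s) P

/-- An elementary process `∑_{i < k} ξ_i 1_{(t_i, t_{i+1}]}`, with `t_0 ≤ t_1 ≤ ⋯` deterministic
and `ξ_i` real-valued and `𝓕 t_i`-measurable. -/
structure ElementaryProcess {Ω : Type*} {mΩ : MeasurableSpace Ω} (𝓕 : Filtration ℝ≥0 mΩ) where
  k : ℕ
  time : ℕ → ℝ≥0
  mono : Monotone time
  ξ : ℕ → Ω → ℝ
  meas : ∀ i, Measurable[𝓕 (time i)] (ξ i)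

namespace ElementaryProcess

/-- The value of an elementary process at time `s`. -/
noncomputable def value {Ω : Type*} {mΩ : MeasurableSpace Ω} {𝓕 : Filtration ℝ≥0 mΩ}
    (S : ElementaryProcess 𝓕) (s : ℝ≥0) (ω : Ω) : ℝ :=
  ∑ i ∈ Finset.range S.k, (Set.Ioc (S.time i) (S.time (i + 1))).indicator (fun _ ↦ S.ξ i ω) s

/-- The elementary stochastic integral over `[0, t]`,
`∑_{i < k} ξ_i (W_{t_{i+1} ∧ t} - W_{t_i ∧ t})`. -/
noncomputable def integral {Ω : Type*} {mΩ : MeasurableSpace Ω} {𝓕 : Filtration ℝ≥0 mΩ}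
    (S : ElementaryProcess 𝓕) (W : ℝ≥0 → Ω → ℝ) (t : ℝ≥0) (ω : Ω) : ℝ :=
  ∑ i ∈ Finset.range S.k,
    S.ξ i ω * (W (min (S.time (i + 1)) t) ω - W (min (S.time i) t) ω)

end ElementaryProcess

/-- The elementary processes `S n` approximate `H` on `[0, t]`:
`∫_0^t |S n - H|² ds → 0` in probability. -/
def ApproximatesOn {Ω : Type*} {mΩ : MeasurableSpace Ω} {𝓕 : Filtration ℝ≥0 mΩ}
    (S : ℕ → ElementaryProcess 𝓕) (H : ℝ≥0 → Ω → ℝ) (t : ℝ≥0) (P : Measure Ω) : Prop :=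
  ∀ ε : ℝ≥0∞, 0 < ε → Tendsto
    (fun n ↦ P {ω | ε ≤ ∫⁻ s in Set.Ioc (0 : ℝ) t,
      ENNReal.ofReal (((S n).value s.toNNReal ω - H s.toNNReal ω) ^ 2)}) atTop (𝓝 0)

/-- `I` is the Itô integral `∫_0^t H dW`: elementary processes approximating `H` on `[0, t]` exist,
and for every such approximation the elementary integrals converge to `I` in probability. -/
def IsItoIntegral {Ω : Type*} {mΩ : MeasurableSpace Ω} (𝓕 : Filtration ℝ≥0 mΩ)
    (W : ℝ≥0 → Ω → ℝ) (P : Measure Ω) (H : ℝ≥0 → Ω → ℝ) (t : ℝ≥0) (I : Ω → ℝ) : Prop :=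
  (∃ S : ℕ → ElementaryProcess 𝓕, ApproximatesOn S H t P) ∧
    ∀ S : ℕ → ElementaryProcess 𝓕, ApproximatesOn S H t P →
      TendstoInMeasure P (fun n ↦ (S n).integral W t) atTop I

/-- `X` is a continuous adapted solution of `dX = μ X dt + σ X dW`, `X_0 = 1`, that is,
`X_t = 1 + ∫_0^t μ X_s ds + ∫_0^t σ X_s dW_s` almost surely for every `t`. -/
structure IsGeometricBrownianMotion {Ω : Type*} {mΩ : MeasurableSpace Ω} (𝓕 : Filtration ℝ≥0 mΩ)
    (W : ℝ≥0 → Ω → ℝ) (P : Measure Ω) (μ σ : ℝ) (X : ℝ≥0 → Ω → ℝ) : Prop where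
  adapted : Adapted 𝓕 X
  cont : ∀ᵐ ω ∂P, Continuous (X · ω)
  eqn : ∃ I : ℝ≥0 → Ω → ℝ,
    (∀ t, IsItoIntegral 𝓕 W P (fun s ω ↦ σ * X s ω) t (I t)) ∧
    ∀ t : ℝ≥0, ∀ᵐ ω ∂P,
      X t ω = 1 + (∫ s in (0 : ℝ)..t, μ * X s.toNNReal ω) + I t ω

/-- The running maximum `max_{0 ≤ t ≤ T} X_t`. -/
noncomputable def runningMax {Ω : Type*} (X : ℝ≥0 → Ω → ℝ) (T : ℝ≥0) (ω : Ω) : ℝ :=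
  ⨆ t : Set.Icc (0 : ℝ≥0) T, X t ω

/-- The event `A_T = {max_{0 ≤ t ≤ T} X_t ≥ B}`. -/
def hitEvent {Ω : Type*} (X : ℝ≥0 → Ω → ℝ) (B : ℝ) (T : ℝ≥0) : Set Ω :=
  {ω | B ≤ runningMax X T ω}

/-- The random variable `sup_{0 ≤ t ≤ T} |X_t - B^{t/T}|`. -/
noncomputable def supDeviation {Ω : Type*} (X : ℝ≥0 → Ω → ℝ) (B : ℝ) (T : ℝ≥0) (ω : Ω) : ℝ :=
  ⨆ t : Set.Icc (0 : ℝ≥0) T, |X t ω - B ^ ((t : ℝ) / (T : ℝ))|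

/-! ### Sums of products of predictable and independent factors -/

lemma indepFun_of_indep_comap {Ω : Type*} {mΩ : MeasurableSpace Ω} {P : Measure Ω}
    {m : MeasurableSpace Ω} {ξ η : Ω → ℝ} (hξ : Measurable[m] ξ)
    (h : Indep (MeasurableSpace.comap η inferInstance) m P) : IndepFun ξ η P := by
  rw [IndepFun_iff_Indep]
  exact (indep_of_indep_of_le_right h hξ.comap_le).symm

lemma memLp_two_mul_of_indepFun {Ω : Type*} {mΩ : MeasurableSpace Ω} {P : Measure Ω}
    {ξ η : Ω → ℝ} (hξ : MemLp ξ 2 P) (hη : MemLp η 2 P) (h : IndepFun ξ η P) :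
    MemLp (fun ω ↦ ξ ω * η ω) 2 P := by
  rw [memLp_two_iff_integrable_sq (f := fun ω ↦ ξ ω * η ω) (hξ.1.mul hη.1)]
  have h2 : IndepFun (fun ω ↦ ξ ω ^ 2) (fun ω ↦ η ω ^ 2) P :=
    h.comp (φ := fun x ↦ x ^ 2) (ψ := fun x ↦ x ^ 2) (by fun_prop) (by fun_prop)
  refine (h2.integrable_mul hξ.integrable_sq hη.integrable_sq).congr ?_
  filter_upwards with ω
  simp [mul_pow]

lemma measurable_sum_range_mul {Ω : Type*} {𝓖 : ℕ → MeasurableSpace Ω}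
    (hmono : Monotone 𝓖) {ξ η : ℕ → Ω → ℝ}
    (hξ : ∀ i, Measurable[𝓖 i] (ξ i)) (hη : ∀ i, Measurable[𝓖 (i + 1)] (η i)) (n : ℕ) :
    Measurable[𝓖 n] (fun ω ↦ ∑ i ∈ Finset.range n, ξ i ω * η i ω) := by
  refine Finset.measurable_fun_sum _ fun i hi ↦ ?_
  rw [Finset.mem_range] at hi
  exact ((hξ i).mono (hmono hi.le) le_rfl).mul ((hη i).mono (hmono (Nat.succ_le_of_lt hi)) le_rfl)

/-- Orthogonality of martingale differences: the `L²` norm of a discrete stochastic integral. -/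
lemma integral_sq_sum_mul_le_of_centered {Ω : Type*} {mΩ : MeasurableSpace Ω} {P : Measure Ω}
    [IsProbabilityMeasure P] {𝓖 : ℕ → MeasurableSpace Ω} (hmono : Monotone 𝓖)
    {ξ η : ℕ → Ω → ℝ} (hξ : ∀ i, Measurable[𝓖 i] (ξ i))
    (hη : ∀ i, Measurable[𝓖 (i + 1)] (η i)) (hξ2 : ∀ i, MemLp (ξ i) 2 P)
    (hη2 : ∀ i, MemLp (η i) 2 P)
    (hind : ∀ i, Indep (MeasurableSpace.comap (η i) inferInstance) (𝓖 i) P)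
    (h0 : ∀ i, ∫ ω, η i ω ∂P = 0) {v : ℝ} (hv : ∀ i, ∫ ω, η i ω ^ 2 ∂P ≤ v) (n : ℕ) :
    ∫ ω, (∑ i ∈ Finset.range n, ξ i ω * η i ω) ^ 2 ∂P
      ≤ v * ∑ i ∈ Finset.range n, ∫ ω, ξ i ω ^ 2 ∂P := by
  have hprod i : MemLp (fun ω ↦ ξ i ω * η i ω) 2 P :=
    memLp_two_mul_of_indepFun (hξ2 i) (hη2 i) (indepFun_of_indep_comap (hξ i) (hind i))
  have hS n : MemLp (fun ω ↦ ∑ i ∈ Finset.range n, ξ i ω * η i ω) 2 P :=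
    memLp_finsetSum _ fun i _ ↦ hprod i
  induction n with
  | zero => simp
  | succ n ih =>
    have hSm := measurable_sum_range_mul hmono hξ hη n
    have hcross : ∫ ω, ((∑ i ∈ Finset.range n, ξ i ω * η i ω) * ξ n ω) * η n ω ∂P = 0 := by
      have : IndepFun (fun ω ↦ (∑ i ∈ Finset.range n, ξ i ω * η i ω) * ξ n ω) (η n) P :=
        indepFun_of_indep_comap (hSm.mul (hξ n)) (hind n)
      rw [this.integral_fun_mul_eq_mul_integral, h0, mul_zero]
      · exact ((hS n).1.mul (hξ2 n).1)
      · exact (hη2 n).1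
    have hsq : ∫ ω, (ξ n ω * η n ω) ^ 2 ∂P ≤ v * ∫ ω, ξ n ω ^ 2 ∂P := by
      have h2 : IndepFun (fun ω ↦ ξ n ω ^ 2) (fun ω ↦ η n ω ^ 2) P :=
        (indepFun_of_indep_comap (hξ n) (hind n)).comp (φ := fun x ↦ x ^ 2) (ψ := fun x ↦ x ^ 2)
          (by fun_prop) (by fun_prop)
      simp_rw [mul_pow]
      rw [h2.integral_fun_mul_eq_mul_integral (hξ2 n).integrable_sq.1 (hη2 n).integrable_sq.1,
        mul_comm]
      exact mul_le_mul_of_nonneg_right (hv n) (integral_nonneg fun ω ↦ sq_nonneg _)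
    have hInt : Integrable
        (fun ω ↦ ((∑ i ∈ Finset.range n, ξ i ω * η i ω) * ξ n ω) * η n ω) P := by
      refine ((hS n).integrable_mul (hprod n)).congr ?_
      filter_upwards with ω
      simp [mul_assoc]
    have hexp : ∀ ω, (∑ i ∈ Finset.range (n + 1), ξ i ω * η i ω) ^ 2 =
        (∑ i ∈ Finset.range n, ξ i ω * η i ω) ^ 2 +
        2 * (((∑ i ∈ Finset.range n, ξ i ω * η i ω) * ξ n ω) * η n ω) +
        (ξ n ω * η n ω) ^ 2 := fun ω ↦ by
      rw [Finset.sum_range_succ]; ring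
    simp_rw [hexp]
    rw [integral_add ((hS n).integrable_sq.fun_add (hInt.const_mul 2)) (hprod n).integrable_sq,
      integral_add (hS n).integrable_sq (hInt.const_mul 2), integral_const_mul, hcross,
      Finset.sum_range_succ]
    linarith

/-- `L²` bound for a sum of products `ξ i * η i`, where `ξ i` is known before the independent
factor `η i`, which has mean `r` and second moment at most `v`. -/
lemma integral_sq_sum_mul_le {Ω : Type*} {mΩ : MeasurableSpace Ω} {P : Measure Ω}
    [IsProbabilityMeasure P] {𝓖 : ℕ → MeasurableSpace Ω} (hmono : Monotone 𝓖)
    {ξ η : ℕ → Ω → ℝ} (hξ : ∀ i, Measurable[𝓖 i] (ξ i))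
    (hη : ∀ i, Measurable[𝓖 (i + 1)] (η i)) (hξ2 : ∀ i, MemLp (ξ i) 2 P)
    (hη2 : ∀ i, MemLp (η i) 2 P)
    (hind : ∀ i, Indep (MeasurableSpace.comap (η i) inferInstance) (𝓖 i) P)
    {r v : ℝ} (hr : ∀ i, ∫ ω, η i ω ∂P = r) (hv : ∀ i, ∫ ω, η i ω ^ 2 ∂P ≤ v) (n : ℕ) :
    ∫ ω, (∑ i ∈ Finset.range n, ξ i ω * η i ω) ^ 2 ∂P
      ≤ 2 * (v + n * r ^ 2) * ∑ i ∈ Finset.range n, ∫ ω, ξ i ω ^ 2 ∂P := by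
  have hη2' i : MemLp (fun ω ↦ η i ω - r) 2 P := (hη2 i).sub (memLp_const r)
  have hc := integral_sq_sum_mul_le_of_centered hmono hξ (η := fun i ω ↦ η i ω - r)
    (fun i ↦ (hη i).sub_const r) hξ2 hη2'
    (fun i ↦ by
      refine indep_of_indep_of_le_left (hind i) ?_
      rintro _ ⟨s, hs, rfl⟩
      exact ⟨(fun x ↦ x - r) ⁻¹' s, (measurable_id.sub_const r) hs, rfl⟩)
    (fun i ↦ by
      rw [integral_sub ((hη2 i).integrable (by simp)) (integrable_const _), hr]; simp)
    (v := v)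
    (fun i ↦ by
      have : ∀ ω, (η i ω - r) ^ 2 = η i ω ^ 2 - (2 * r) * η i ω + r ^ 2 := fun ω ↦ by ring
      simp_rw [this]
      have h1 := (hη2 i).integrable_sq
      have h2 := ((hη2 i).integrable (by simp)).const_mul (2 * r)
      rw [integral_add (f := fun ω ↦ η i ω ^ 2 - 2 * r * η i ω) (h1.sub h2) (integrable_const _), integral_sub h1 h2, integral_const_mul, hr]
      simp
      nlinarith [hv i, sq_nonneg r]) n
  have hprod i : MemLp (fun ω ↦ ξ i ω * (η i ω - r)) 2 P := by
    refine memLp_two_mul_of_indepFun (hξ2 i) (hη2' i) ?_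
    exact (indepFun_of_indep_comap (hξ i) (hind i)).comp (φ := id) (ψ := fun x ↦ x - r)
      measurable_id (measurable_id.sub_const r)
  have hI1 : Integrable (fun ω ↦ (∑ i ∈ Finset.range n, ξ i ω * (η i ω - r)) ^ 2) P :=
    (memLp_finsetSum _ fun i _ ↦ hprod i).integrable_sq
  have hI2 : Integrable (fun ω ↦ ∑ i ∈ Finset.range n, ξ i ω ^ 2) P :=
    integrable_finsetSum _ fun i _ ↦ (hξ2 i).integrable_sq
  calc ∫ ω, (∑ i ∈ Finset.range n, ξ i ω * η i ω) ^ 2 ∂P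
      ≤ ∫ ω, (2 * (∑ i ∈ Finset.range n, ξ i ω * (η i ω - r)) ^ 2 +
          (2 * n * r ^ 2) * ∑ i ∈ Finset.range n, ξ i ω ^ 2) ∂P := by
        refine integral_mono_of_nonneg (Eventually.of_forall fun ω ↦ sq_nonneg _)
          ((hI1.const_mul 2).add (hI2.const_mul _)) (Eventually.of_forall fun ω ↦ ?_)
        have h1 : ∑ i ∈ Finset.range n, ξ i ω * η i ω =
            ∑ i ∈ Finset.range n, ξ i ω * (η i ω - r) + r * ∑ i ∈ Finset.range n, ξ i ω := by
          rw [Finset.mul_sum, ← Finset.sum_add_distrib]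
          exact Finset.sum_congr rfl fun i _ ↦ by ring
        have h2 := sq_sum_le_card_mul_sum_sq (s := Finset.range n) (f := fun i ↦ ξ i ω)
        rw [Finset.card_range] at h2
        simp only
        rw [h1]
        nlinarith [sq_nonneg (∑ i ∈ Finset.range n, ξ i ω * (η i ω - r) -
          r * ∑ i ∈ Finset.range n, ξ i ω), mul_le_mul_of_nonneg_left h2 (sq_nonneg r)]
    _ ≤ _ := by
        rw [integral_add (hI1.const_mul 2) (hI2.const_mul _), integral_const_mul,
          integral_const_mul, integral_finsetSum _ fun i _ ↦ (hξ2 i).integrable_sq]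
        linarith

/-! ### The second order remainder of the exponential of a Gaussian increment -/

lemma abs_exp_sub_one_sub_le (x : ℝ) : |Real.exp x - 1 - x| ≤ x ^ 2 * Real.exp |x| := by
  have h0 := Real.add_one_le_exp x
  rw [abs_of_nonneg (by linarith)]
  have h1 : Real.exp x * (1 - x) ≤ 1 := by
    have := Real.add_one_le_exp (-x)
    calc Real.exp x * (1 - x) ≤ Real.exp x * Real.exp (-x) := by gcongr; linarith
      _ = 1 := by rw [← Real.exp_add]; simp
  have h2 : x * (Real.exp x - 1) ≤ x ^ 2 * Real.exp |x| := by
    rcases le_or_gt 0 x with hx | hx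
    · rw [abs_of_nonneg hx]; nlinarith
    · have := Real.one_le_exp (abs_nonneg x)
      nlinarith [sq_nonneg x]
  nlinarith

/-- The error of the Euler step for geometric Brownian motion. -/
noncomputable def eulerRemainder (μ σ : ℝ) (d : ℝ) (w : ℝ) : ℝ :=
  Real.exp (σ * w + (μ - σ ^ 2 / 2) * d) - 1 - (μ * d + σ * w)

@[fun_prop]
lemma measurable_eulerRemainder (μ σ d : ℝ) : Measurable (eulerRemainder μ σ d) := by
  unfold eulerRemainder
  fun_prop

lemma memLp_two_exp_mul_gaussianReal (a : ℝ) (d : ℝ≥0) :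
    MemLp (fun w ↦ Real.exp (a * w)) 2 (gaussianReal 0 d) := by
  rw [memLp_two_iff_integrable_sq (by fun_prop)]
  refine (integrable_exp_mul_gaussianReal (2 * a)).congr ?_
  filter_upwards with w
  rw [← Real.exp_nat_mul]
  congr 1
  push_cast
  ring

lemma memLp_two_eulerRemainder (μ σ : ℝ) (d : ℝ≥0) :
    MemLp (eulerRemainder μ σ d) 2 (gaussianReal 0 d) := by
  unfold eulerRemainder
  simp_rw [Real.exp_add]
  have h1 : MemLp (fun w : ℝ ↦ w) 2 (gaussianReal 0 d) := memLp_id_gaussianReal 2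
  exact (((memLp_two_exp_mul_gaussianReal σ d).mul_const _).sub (memLp_const 1)).sub
    ((memLp_const (μ * (d : ℝ))).add (h1.const_mul σ))

lemma integral_eulerRemainder (μ σ : ℝ) (d : ℝ≥0) :
    ∫ w, eulerRemainder μ σ d w ∂(gaussianReal 0 d) = Real.exp (μ * d) - 1 - μ * d := by
  unfold eulerRemainder
  simp_rw [Real.exp_add]
  have h1 : Integrable (fun w : ℝ ↦ w) (gaussianReal 0 d) :=
    (memLp_id_gaussianReal 1).integrable (by simp)
  have h2 := (integrable_exp_mul_gaussianReal (μ := 0) (v := d) σ)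
  have h3 : ∫ w, Real.exp (σ * w) ∂(gaussianReal 0 d) = Real.exp (d * σ ^ 2 / 2) := by
    have := congrFun (mgf_id_gaussianReal (μ := 0) (v := d)) σ
    simpa [mgf] using this
  rw [integral_sub
    (f := fun w ↦ Real.exp (σ * w) * Real.exp ((μ - σ ^ 2 / 2) * ↑d) - 1)
    ((h2.mul_const _).sub (integrable_const _))
    ((integrable_const _).fun_add (h1.const_mul σ)), integral_sub (h2.mul_const _) (integrable_const _),
    integral_add (integrable_const _) (h1.const_mul σ), integral_mul_const, integral_const_mul σ,
    integral_id_gaussianReal, h3, ← Real.exp_add]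
  simp
  ring_nf

lemma gaussianReal_eq_map_sqrt_mul (d : ℝ≥0) :
    gaussianReal 0 d = (gaussianReal 0 1).map (fun z ↦ √d * z) := by
  rw [gaussianReal_map_const_mul]
  congr 1
  · simp
  · ext; simp

/-- Mean and second moment of the Euler remainder are of second order. -/
lemma exists_eulerRemainder_bound (μ σ : ℝ) : ∃ K : ℝ, 0 ≤ K ∧ ∀ d : ℝ≥0, d ≤ 1 →
    |∫ w, eulerRemainder μ σ d w ∂(gaussianReal 0 d)| ≤ K * d ^ 2 ∧
    ∫ w, eulerRemainder μ σ d w ^ 2 ∂(gaussianReal 0 d) ≤ K * d ^ 2 := by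
  set ν := μ - σ ^ 2 / 2 with hν
  have hInt : Integrable (fun z : ℝ ↦ (2 + σ ^ 2) ^ 2 *
      (Real.exp (4 * |ν|) * Real.exp (|4 * σ| * |z|))) (gaussianReal 0 1) :=
    ((integrable_exp_abs_mul_abs (X := fun z ↦ z) (integrable_exp_mul_gaussianReal (4 * σ))
      (integrable_exp_mul_gaussianReal (-(4 * σ)))).const_mul _).const_mul _
  set K₁ := ∫ z, (2 + σ ^ 2) ^ 2 * (Real.exp (4 * |ν|) * Real.exp (|4 * σ| * |z|))
    ∂(gaussianReal 0 1) with hK₁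
  have hK₁0 : 0 ≤ K₁ := integral_nonneg fun z ↦ by positivity
  have hE0 : 0 ≤ μ ^ 2 * Real.exp |μ| := by positivity
  refine ⟨K₁ + μ ^ 2 * Real.exp |μ|, by positivity, fun d hd ↦ ⟨?_, ?_⟩⟩
  · rw [integral_eulerRemainder]
    refine (abs_exp_sub_one_sub_le _).trans ?_
    have hd' : (d : ℝ) ≤ 1 := by exact_mod_cast hd
    have : Real.exp |μ * d| ≤ Real.exp |μ| := by
      rw [abs_mul, abs_of_nonneg d.coe_nonneg]
      gcongr
      exact mul_le_of_le_one_right (abs_nonneg _) hd'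
    calc (μ * d) ^ 2 * Real.exp |μ * d| ≤ (μ * d) ^ 2 * Real.exp |μ| := by gcongr
      _ = (0 + μ ^ 2 * Real.exp |μ|) * d ^ 2 := by ring
      _ ≤ _ := by gcongr
  · rw [gaussianReal_eq_map_sqrt_mul, integral_map (by fun_prop) (by fun_prop)]
    calc ∫ z, eulerRemainder μ σ d (√d * z) ^ 2 ∂(gaussianReal 0 1)
        ≤ ∫ z, d ^ 2 * ((2 + σ ^ 2) ^ 2 * (Real.exp (4 * |ν|) * Real.exp (|4 * σ| * |z|)))
          ∂(gaussianReal 0 1) := by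
          refine integral_mono_of_nonneg (Eventually.of_forall fun z ↦ sq_nonneg _)
            (hInt.const_mul _) (Eventually.of_forall fun z ↦ ?_)
          simp only
          set x := σ * (√d * z) + ν * d with hx
          set q := |σ| * |z| + |ν| with hq
          have hq0 : 0 ≤ q := by positivity
          have hs : √(d : ℝ) * √d = d := Real.mul_self_sqrt d.coe_nonneg
          have hs0 := Real.sqrt_nonneg (d : ℝ)
          have hd' : (d : ℝ) ≤ 1 := by exact_mod_cast hd
          have hs1 : √(d : ℝ) ≤ 1 := Real.sqrt_le_one.2 hd'
          have hds : (d : ℝ) ≤ √d := by nlinarith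
          have hxq : |x| ≤ √d * q := by
            calc |x| ≤ |σ * (√d * z)| + |ν * d| := abs_add_le _ _
              _ = √d * (|σ| * |z|) + |ν| * d := by
                rw [abs_mul, abs_mul, abs_mul, abs_of_nonneg hs0, abs_of_nonneg d.coe_nonneg]; ring
              _ ≤ √d * (|σ| * |z|) + |ν| * √d := by gcongr
              _ = √d * q := by rw [hq]; ring
          have hxq' : |x| ≤ q := hxq.trans (mul_le_of_le_one_left hq0 hs1)
          have hx2 : x ^ 2 ≤ d * q ^ 2 := by
            rw [← sq_abs]
            calc |x| ^ 2 ≤ (√d * q) ^ 2 := by gcongr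
              _ = d * q ^ 2 := by rw [mul_pow, sq (√(d : ℝ)), hs]
          have hqe : q ^ 2 ≤ 2 * Real.exp q := by
            nlinarith [Real.quadratic_le_exp_of_nonneg hq0]
          have h1 : 1 ≤ Real.exp (2 * q) := Real.one_le_exp (by positivity)
          have hR : |eulerRemainder μ σ d (√d * z)| ≤ d * ((2 + σ ^ 2) * Real.exp (2 * q)) := by
            have e1 : eulerRemainder μ σ d (√d * z) =
                (Real.exp x - 1 - x) - σ ^ 2 / 2 * d := by
              unfold eulerRemainder; rw [hx, hν]; ring
            calc |eulerRemainder μ σ d (√d * z)|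
                ≤ |Real.exp x - 1 - x| + |σ ^ 2 / 2 * d| := by rw [e1]; exact abs_sub _ _
              _ ≤ x ^ 2 * Real.exp |x| + σ ^ 2 / 2 * d := by
                rw [abs_of_nonneg (by positivity : (0:ℝ) ≤ σ ^ 2 / 2 * d)]
                gcongr; exact abs_exp_sub_one_sub_le x
              _ ≤ (d * (2 * Real.exp q)) * Real.exp q + σ ^ 2 / 2 * d := by
                gcongr
                exact hx2.trans (by gcongr)
              _ = d * (2 * Real.exp (2 * q) + σ ^ 2 / 2 * 1) := by
                rw [show 2 * q = q + q by ring, Real.exp_add q q]; ring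
              _ ≤ d * (2 * Real.exp (2 * q) + σ ^ 2 * Real.exp (2 * q)) := by
                gcongr
                linarith [sq_nonneg σ]
              _ = _ := by ring
          calc eulerRemainder μ σ d (√d * z) ^ 2
              = |eulerRemainder μ σ d (√d * z)| ^ 2 := (sq_abs _).symm
            _ ≤ (d * ((2 + σ ^ 2) * Real.exp (2 * q))) ^ 2 := by gcongr
            _ = _ := by
              have : Real.exp (4 * |ν|) * Real.exp (|4 * σ| * |z|) = Real.exp (2 * q) ^ 2 := by
                rw [← Real.exp_nat_mul, ← Real.exp_add, hq, abs_mul]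
                congr 1
                norm_num
                ring
              rw [this]; ring
      _ = K₁ * d ^ 2 := by rw [integral_const_mul]; ring
      _ ≤ _ := by gcongr; linarith

/-! ### Uniform grids and step approximations -/

/-- The `i`-th point of the uniform grid with `n + 1` steps on `[0, t]`. -/
noncomputable def gridTime (t : ℝ≥0) (n i : ℕ) : ℝ≥0 := i * (t / (n + 1))

lemma gridTime_zero (t : ℝ≥0) (n : ℕ) : gridTime t n 0 = 0 := by simp [gridTime]

lemma gridTime_last (t : ℝ≥0) (n : ℕ) : gridTime t n (n + 1) = t := by
  simp only [gridTime, Nat.cast_add, Nat.cast_one]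
  exact mul_div_cancel₀ _ (by positivity)

lemma gridTime_succ (t : ℝ≥0) (n i : ℕ) :
    gridTime t n (i + 1) = gridTime t n i + t / (n + 1) := by
  simp only [gridTime, Nat.cast_add, Nat.cast_one]
  ring

lemma monotone_gridTime (t : ℝ≥0) (n : ℕ) : Monotone (gridTime t n) :=
  monotone_nat_of_le_succ fun i ↦ by rw [gridTime_succ]; exact le_self_add

lemma gridTime_le {t : ℝ≥0} {n i : ℕ} (hi : i ≤ n + 1) : gridTime t n i ≤ t :=
  (monotone_gridTime t n hi).trans_eq (gridTime_last t n)

lemma tendsto_mesh (t : ℝ≥0) : Tendsto (fun n : ℕ ↦ (t : ℝ) / (n + 1)) atTop (𝓝 0) :=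
  tendsto_const_div_atTop_nhds_zero_nat (t : ℝ) |>.comp (tendsto_add_atTop_nat 1) |>.congr
    fun n ↦ by simp

/-- A continuous path oscillates little on every cell of a fine grid. -/
lemma eventually_grid_osc_le {f : ℝ≥0 → ℝ} (hf : Continuous f) (t : ℝ≥0) {ε : ℝ} (hε : 0 < ε) :
    ∀ᶠ n : ℕ in atTop, ∀ i < n + 1, ∀ s ∈ Set.Icc (gridTime t n i) (gridTime t n (i + 1)),
      |f (gridTime t n i) - f s| ≤ ε := by
  have huc := (isCompact_Icc (a := (0 : ℝ≥0)) (b := t)).uniformContinuousOn_of_continuous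
    hf.continuousOn
  rw [Metric.uniformContinuousOn_iff] at huc
  obtain ⟨δ, hδ, h⟩ := huc ε hε
  filter_upwards [(tendsto_mesh t).eventually_lt_const hδ] with n hn i hi s hs
  refine (h (gridTime t n i) ⟨zero_le, gridTime_le hi.le⟩ s
    ⟨zero_le, hs.2.trans (gridTime_le hi)⟩ ?_).le
  refine lt_of_le_of_lt ?_ hn
  have h1 : (gridTime t n i : ℝ) ≤ s := hs.1
  have h2 : (s : ℝ) ≤ gridTime t n i + t / (n + 1) := by
    have := NNReal.coe_le_coe.2 (hs.2.trans_eq (gridTime_succ t n i))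
    push_cast at this
    exact this
  rw [NNReal.dist_eq, abs_le]
  constructor <;> linarith

lemma exists_mem_grid_cell {t s : ℝ≥0} (n : ℕ) (hs0 : 0 < s) (hst : s ≤ t) :
    ∃ i < n + 1, s ∈ Set.Ioc (gridTime t n i) (gridTime t n (i + 1)) := by
  have hex : ∃ k, s ≤ gridTime t n k := ⟨n + 1, hst.trans_eq (gridTime_last t n).symm⟩
  classical
  have hk := Nat.find_spec hex
  have hmin := fun m ↦ Nat.find_min hex (m := m)
  have hle := Nat.find_min' hex (hst.trans_eq (gridTime_last t n).symm)
  rcases h : Nat.find hex with _ | k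
  · rw [h, gridTime_zero] at hk
    exact absurd hk (not_le.2 hs0)
  · rw [h] at hk hle hmin
    exact ⟨k, by omega, not_le.1 (hmin k (by omega)), hk⟩

lemma sum_grid_indicator_eq {t s : ℝ≥0} {n i : ℕ} (hi : i < n + 1)
    (hs : s ∈ Set.Ioc (gridTime t n i) (gridTime t n (i + 1))) (a : ℕ → ℝ) :
    ∑ j ∈ Finset.range (n + 1),
      (Set.Ioc (gridTime t n j) (gridTime t n (j + 1))).indicator (fun _ ↦ a j) s = a i := by
  rw [Finset.sum_eq_single i]
  · rw [Set.indicator_of_mem hs]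
  · intro j _ hji
    refine Set.indicator_of_notMem (fun hj ↦ ?_) _
    exact Set.disjoint_left.1 ((monotone_gridTime t n).pairwise_disjoint_on_Ioc_succ hji) hj hs
  · intro h
    exact absurd (Finset.mem_range.2 hi) h

/-- Left Riemann sums of a continuous path converge to its integral. -/
lemma tendsto_grid_riemann_sum {f : ℝ≥0 → ℝ} (hf : Continuous f) (t : ℝ≥0) :
    Tendsto (fun n : ℕ ↦ ∑ i ∈ Finset.range (n + 1), f (gridTime t n i) * (t / (n + 1)))
      atTop (𝓝 (∫ s in (0 : ℝ)..t, f s.toNNReal)) := by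
  rw [Metric.tendsto_atTop']
  intro ε hε
  have hε' : 0 < ε / (2 * (t + 1)) := by positivity
  obtain ⟨N, hN⟩ := eventually_atTop.1 (eventually_grid_osc_le hf t hε')
  refine ⟨N, fun n hn ↦ ?_⟩
  have hcont : Continuous fun s : ℝ ↦ f s.toNNReal := hf.comp continuous_real_toNNReal
  have hsum : ∑ i ∈ Finset.range (n + 1),
      ∫ s in (gridTime t n i : ℝ)..(gridTime t n (i + 1) : ℝ), f s.toNNReal
      = ∫ s in (0 : ℝ)..t, f s.toNNReal := by
    rw [intervalIntegral.sum_integral_adjacent_intervals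
      (a := fun i ↦ (gridTime t n i : ℝ)) fun k _ ↦ hcont.intervalIntegrable _ _,
      gridTime_zero, gridTime_last]
    simp
  have hcell (i : ℕ) : (gridTime t n (i + 1) : ℝ) - gridTime t n i = t / (n + 1) := by
    rw [gridTime_succ]; push_cast; ring
  rw [← hsum, dist_eq_norm, ← Finset.sum_sub_distrib]
  calc ‖∑ i ∈ Finset.range (n + 1), (f (gridTime t n i) * (t / (n + 1)) -
        ∫ s in (gridTime t n i : ℝ)..(gridTime t n (i + 1) : ℝ), f s.toNNReal)‖
      ≤ ∑ i ∈ Finset.range (n + 1), ε / (2 * (t + 1)) * (t / (n + 1)) := by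
        refine norm_sum_le_of_le _ fun i hi ↦ ?_
        have hmono : (gridTime t n i : ℝ) ≤ gridTime t n (i + 1) :=
          monotone_gridTime t n (Nat.le_succ i)
        have e1 : f (gridTime t n i) * (t / (n + 1)) =
            ∫ s in (gridTime t n i : ℝ)..(gridTime t n (i + 1) : ℝ), f (gridTime t n i) := by
          rw [intervalIntegral.integral_const, hcell, smul_eq_mul, mul_comm]
        rw [e1, ← intervalIntegral.integral_sub intervalIntegrable_const
          (hcont.intervalIntegrable _ _)]
        refine (intervalIntegral.norm_integral_le_of_norm_le_const
          (C := ε / (2 * (t + 1))) fun s hs ↦ ?_).trans_eq ?_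
        · rw [Set.uIoc_of_le hmono] at hs
          refine hN n hn.le i (Finset.mem_range.1 hi) _ ⟨?_, ?_⟩
          · exact NNReal.le_toNNReal_of_coe_le hs.1.le
          · exact Real.toNNReal_le_iff_le_coe.2 hs.2
        · rw [hcell, abs_of_nonneg (by positivity)]
    _ = ε / 2 * (t / (t + 1)) := by
        rw [Finset.sum_const, Finset.card_range, nsmul_eq_mul]
        push_cast
        field_simp
    _ ≤ ε / 2 * 1 := by
        gcongr
        rw [div_le_one (by positivity)]
        linarith
    _ < ε := by linarith

section Grid

variable {Ω : Type*} {mΩ : MeasurableSpace Ω} {𝓕 : Filtration ℝ≥0 mΩ}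

/-- The elementary process that samples an adapted process at the left grid points. -/
noncomputable def gridProcess (H : ℝ≥0 → Ω → ℝ) (hH : Adapted 𝓕 H) (t : ℝ≥0) (n : ℕ) :
    ElementaryProcess 𝓕 where
  k := n + 1
  time := gridTime t n
  mono := monotone_gridTime t n
  ξ i := H (gridTime t n i)
  meas _ := hH _

lemma gridProcess_integral (H : ℝ≥0 → Ω → ℝ) (hH : Adapted 𝓕 H) (t : ℝ≥0) (n : ℕ)
    (W : ℝ≥0 → Ω → ℝ) (ω : Ω) :
    (gridProcess H hH t n).integral W t ω = ∑ i ∈ Finset.range (n + 1),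
      H (gridTime t n i) ω * (W (gridTime t n (i + 1)) ω - W (gridTime t n i) ω) := by
  refine Finset.sum_congr rfl fun i hi ↦ ?_
  have hi' : i < n + 1 := Finset.mem_range.1 hi
  simp only [gridProcess, min_eq_left (gridTime_le hi'.le), min_eq_left (gridTime_le hi')]

lemma measurable_gridProcess_value (H : ℝ≥0 → Ω → ℝ) (hH : Adapted 𝓕 H) (t : ℝ≥0) (n : ℕ) :
    Measurable fun p : Ω × ℝ ↦ (gridProcess H hH t n).value p.2.toNNReal p.1 := by
  unfold ElementaryProcess.value
  refine Finset.measurable_fun_sum _ fun i _ ↦ ?_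
  have : (fun p : Ω × ℝ ↦ (Set.Ioc ((gridProcess H hH t n).time i)
      ((gridProcess H hH t n).time (i + 1))).indicator
      (fun _ ↦ (gridProcess H hH t n).ξ i p.1) p.2.toNNReal) =
      ((fun p : Ω × ℝ ↦ p.2.toNNReal) ⁻¹' (Set.Ioc ((gridProcess H hH t n).time i)
      ((gridProcess H hH t n).time (i + 1)))).indicator
      (fun p ↦ (gridProcess H hH t n).ξ i p.1) := by
    ext p
    simp only [Set.indicator, Set.mem_preimage]
  rw [this]
  refine Measurable.indicator ?_ ?_
  · exact (((gridProcess H hH t n).meas i).mono (𝓕.le _) le_rfl).comp measurable_fst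
  · exact measurableSet_Ioc.preimage (by fun_prop)

/-- Sampling an adapted, almost surely continuous process on fine grids approximates it. -/
lemma approximatesOn_gridProcess {P : Measure Ω} [IsProbabilityMeasure P] {H : ℝ≥0 → Ω → ℝ}
    (hH : Adapted 𝓕 H) (hc : ∀ᵐ ω ∂P, Continuous (H · ω)) (t : ℝ≥0) :
    ApproximatesOn (gridProcess H hH t) H t P := by
  obtain ⟨C, hCsub, hCm, hC0⟩ := exists_measurable_superset_of_null hc
  -- a jointly measurable version of `H`
  let H' : ℝ≥0 → Ω → ℝ := fun s ↦ Cᶜ.indicator (H s)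
  have hH'c ω : Continuous (H' · ω) := by
    by_cases hω : ω ∈ C
    · simpa [H', hω] using continuous_const
    · have : Continuous (H · ω) := by
        by_contra h
        exact hω (hCsub h)
      simpa [H', hω] using this
  have hH'm : Measurable (Function.uncurry H') :=
    measurable_uncurry_of_continuous_of_measurable hH'c
      fun s ↦ ((hH s).mono (𝓕.le s) le_rfl).indicator hCm.compl
  let L : ℕ → Ω → ℝ≥0∞ := fun n ω ↦ ∫⁻ s in Set.Ioc (0 : ℝ) t,
      ENNReal.ofReal (((gridProcess H hH t n).value s.toNNReal ω - H s.toNNReal ω) ^ 2)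
  let L' : ℕ → Ω → ℝ≥0∞ := fun n ω ↦ ∫⁻ s in Set.Ioc (0 : ℝ) t,
      ENNReal.ofReal (((gridProcess H hH t n).value s.toNNReal ω - H' s.toNNReal ω) ^ 2)
  have hL'm n : Measurable (L' n) := by
    refine Measurable.lintegral_prod_right' (f := fun p : Ω × ℝ ↦ ENNReal.ofReal
      (((gridProcess H hH t n).value p.2.toNNReal p.1 - H' p.2.toNNReal p.1) ^ 2)) ?_
    refine (((measurable_gridProcess_value H hH t n).sub ?_).pow_const 2).ennreal_ofReal
    exact hH'm.comp (f := fun p : Ω × ℝ ↦ (p.2.toNNReal, p.1)) (by fun_prop)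
  have hLL' n : L n =ᵐ[P] L' n := by
    have : ∀ᵐ ω ∂P, ω ∉ C := measure_eq_zero_iff_ae_notMem.1 hC0
    filter_upwards [this] with ω hω
    simp [L, L', H', hω]
  have hLlim : ∀ᵐ ω ∂P, Tendsto (fun n ↦ L n ω) atTop (𝓝 0) := by
    filter_upwards [hc] with ω hω
    rw [ENNReal.tendsto_nhds_zero]
    intro ε hε
    obtain ⟨δ, hδ, hδε⟩ : ∃ δ : ℝ, 0 < δ ∧ ENNReal.ofReal (δ ^ 2) * ENNReal.ofReal t ≤ ε := by
      have h1 : Tendsto (fun δ : ℝ ↦ ENNReal.ofReal (δ ^ 2 * t)) (𝓝[>] 0) (𝓝 0) := by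
        have h2 : Continuous fun δ : ℝ ↦ ENNReal.ofReal (δ ^ 2 * t) :=
          ENNReal.continuous_ofReal.comp (by fun_prop)
        have := (h2.tendsto 0).mono_left (nhdsWithin_le_nhds (s := Set.Ioi 0))
        simpa using this
      obtain ⟨δ, h, h0⟩ := ((h1.eventually (ge_mem_nhds hε)).and self_mem_nhdsWithin).exists
      refine ⟨δ, h0, ?_⟩
      rwa [← ENNReal.ofReal_mul (by positivity)]
    filter_upwards [eventually_grid_osc_le hω t hδ] with n hn
    calc L n ω ≤ ∫⁻ s in Set.Ioc (0 : ℝ) t, ENNReal.ofReal (δ ^ 2) := by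
          refine setLIntegral_mono' measurableSet_Ioc fun s hs ↦ ENNReal.ofReal_le_ofReal ?_
          obtain ⟨i, hi, his⟩ := exists_mem_grid_cell (t := t) (s := s.toNNReal) n
            (Real.toNNReal_pos.2 hs.1) (Real.toNNReal_le_iff_le_coe.2 hs.2)
          have hval : (gridProcess H hH t n).value s.toNNReal ω = H (gridTime t n i) ω :=
            sum_grid_indicator_eq hi his fun j ↦ H (gridTime t n j) ω
          rw [hval, ← sq_abs]
          gcongr
          exact hn i hi _ ⟨his.1.le, his.2⟩
      _ = ENNReal.ofReal (δ ^ 2) * ENNReal.ofReal t := by simp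
      _ ≤ ε := hδε
  intro ε hε
  have hset n : NullMeasurableSet {ω | ε ≤ L n ω} P :=
    nullMeasurableSet_le aemeasurable_const ⟨L' n, hL'm n, hLL' n⟩
  change Tendsto (fun n ↦ P {ω | ε ≤ L n ω}) atTop (𝓝 0)
  have hP n : P {ω | ε ≤ L n ω} = ∫⁻ ω, {ω | ε ≤ L n ω}.indicator 1 ω ∂P :=
    (lintegral_indicator_one₀ (hset n)).symm
  simp_rw [hP]
  have := tendsto_lintegral_of_dominated_convergence' (μ := P)
    (F := fun n ω ↦ {ω | ε ≤ L n ω}.indicator (1 : Ω → ℝ≥0∞) ω) (f := fun _ ↦ 0) (fun _ ↦ 1)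
    (fun n ↦ aemeasurable_one.indicator₀ (hset n))
    (fun n ↦ Eventually.of_forall fun ω ↦ Set.indicator_le_self' (fun _ _ ↦ zero_le) ω) (by simp)
    (by
      filter_upwards [hLlim] with ω hω
      refine tendsto_const_nhds.congr' ?_
      filter_upwards [hω.eventually_lt_const hε] with n hn
      rw [Set.indicator_of_notMem]
      simpa using hn)
  simpa using this

end Grid

/-! ### Pathwise uniqueness for geometric Brownian motion -/

section Uniqueness

variable {Ω : Type*} {mΩ : MeasurableSpace Ω} {𝓕 : Filtration ℝ≥0 mΩ} {P : Measure Ω}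
  {W X : ℝ≥0 → Ω → ℝ} {μ σ : ℝ}

/-- The explicit geometric Brownian motion driven by `W`. -/
noncomputable def gbm (μ σ : ℝ) (W : ℝ≥0 → Ω → ℝ) (t : ℝ≥0) (ω : Ω) : ℝ :=
  Real.exp (σ * W t ω + (μ - σ ^ 2 / 2) * t)

/-- The Euler sum for `∫ μ Z ds + ∫ σ Z dW` on a uniform grid of `[0, t]`. -/
noncomputable def eulerSum (μ σ : ℝ) (W Z : ℝ≥0 → Ω → ℝ) (t : ℝ≥0) (n : ℕ) (ω : Ω) : ℝ :=
  ∑ i ∈ Finset.range (n + 1), Z (gridTime t n i) ω *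
    (μ * (t / (n + 1)) + σ * (W (gridTime t n (i + 1)) ω - W (gridTime t n i) ω))

lemma gbm_sub_one_sub_eulerSum {ω : Ω} (h0 : W 0 ω = 0) (t : ℝ≥0) (n : ℕ) :
    gbm μ σ W t ω - 1 - eulerSum μ σ W (gbm μ σ W) t n ω =
      ∑ i ∈ Finset.range (n + 1), gbm μ σ W (gridTime t n i) ω *
        eulerRemainder μ σ (t / (n + 1) : ℝ≥0)
          (W (gridTime t n (i + 1)) ω - W (gridTime t n i) ω) := by
  have htel : gbm μ σ W t ω - 1 = ∑ i ∈ Finset.range (n + 1),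
      (gbm μ σ W (gridTime t n (i + 1)) ω - gbm μ σ W (gridTime t n i) ω) := by
    rw [Finset.sum_range_sub (fun i ↦ gbm μ σ W (gridTime t n i) ω), gridTime_last, gridTime_zero]
    simp [gbm, h0]
  rw [htel, eulerSum, ← Finset.sum_sub_distrib]
  refine Finset.sum_congr rfl fun i _ ↦ ?_
  have hstep : gbm μ σ W (gridTime t n (i + 1)) ω = gbm μ σ W (gridTime t n i) ω *
      Real.exp (σ * (W (gridTime t n (i + 1)) ω - W (gridTime t n i) ω) +
        (μ - σ ^ 2 / 2) * (t / (n + 1) : ℝ≥0)) := by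
    rw [gbm, gbm, ← Real.exp_add, gridTime_succ]
    push_cast
    ring_nf
  rw [hstep, eulerRemainder]
  push_cast
  ring

lemma hasLaw_grid_increment (hW : IsBrownianReal W P) (t : ℝ≥0) (n i : ℕ) :
    HasLaw (fun ω ↦ W (gridTime t n (i + 1)) ω - W (gridTime t n i) ω)
      (gaussianReal 0 (t / (n + 1))) P := by
  have h := hW.hasLaw_sub (gridTime t n (i + 1)) (gridTime t n i)
  have e : nndist (gridTime t n (i + 1)).1 (gridTime t n i).1 = t / (n + 1) := by
    ext
    rw [coe_nndist, gridTime_succ, Real.dist_eq]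
    have : (gridTime t n i + t / (n + 1) : ℝ≥0).1 - (gridTime t n i).1 = (t / (n + 1) : ℝ≥0) := by
      simp
    rw [this, abs_of_nonneg (NNReal.coe_nonneg _)]
  rw [e] at h
  exact h

lemma IsBrownianWrt.indep_comp_grid_increment (hW : IsBrownianWrt 𝓕 W P) (t : ℝ≥0) (n i : ℕ)
    {φ : ℝ → ℝ} (hφ : Measurable φ) :
    Indep (MeasurableSpace.comap
      (fun ω ↦ φ (W (gridTime t n (i + 1)) ω - W (gridTime t n i) ω)) inferInstance)
      (𝓕 (gridTime t n i)) P := by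
  refine indep_of_indep_of_le_left
    (hW.indep (gridTime t n i) (gridTime t n (i + 1)) (monotone_gridTime t n (Nat.le_succ i))) ?_
  rintro _ ⟨s, hs, rfl⟩
  exact ⟨φ ⁻¹' s, hφ hs, rfl⟩

lemma IsBrownianWrt.measurable_comp_grid_increment (hW : IsBrownianWrt 𝓕 W P) (t : ℝ≥0) (n i : ℕ)
    {φ : ℝ → ℝ} (hφ : Measurable φ) :
    Measurable[𝓕 (gridTime t n (i + 1))]
      (fun ω ↦ φ (W (gridTime t n (i + 1)) ω - W (gridTime t n i) ω)) := by
  refine hφ.comp (Measurable.sub (hW.adapted _) ?_)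
  exact (hW.adapted _).mono (𝓕.mono (monotone_gridTime t n (Nat.le_succ i))) le_rfl

/-- `L²` bound for sums of an adapted process against functions of the Brownian increments. -/
lemma IsBrownianWrt.integral_sq_grid_sum_le [IsProbabilityMeasure P] (hW : IsBrownianWrt 𝓕 W P)
    {Z : ℝ≥0 → Ω → ℝ} (hZ : Adapted 𝓕 Z) (hZ2 : ∀ s, MemLp (Z s) 2 P) (t : ℝ≥0) (n : ℕ)
    {φ : ℝ → ℝ} (hφ : Measurable φ) (hφ2 : MemLp φ 2 (gaussianReal 0 (t / (n + 1)))) {v : ℝ}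
    (hv : ∫ w, φ w ^ 2 ∂(gaussianReal 0 (t / (n + 1))) ≤ v) :
    ∫ ω, (∑ i ∈ Finset.range (n + 1), Z (gridTime t n i) ω *
        φ (W (gridTime t n (i + 1)) ω - W (gridTime t n i) ω)) ^ 2 ∂P
      ≤ 2 * (v + (n + 1) * (∫ w, φ w ∂(gaussianReal 0 (t / (n + 1)))) ^ 2) *
        ∑ i ∈ Finset.range (n + 1), ∫ ω, Z (gridTime t n i) ω ^ 2 ∂P := by
  have hlaw i := hasLaw_grid_increment hW.isBrownian t n i
  have := integral_sq_sum_mul_le (P := P) (𝓖 := fun i ↦ 𝓕 (gridTime t n i))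
    (fun i j hij ↦ 𝓕.mono (monotone_gridTime t n hij))
    (ξ := fun i ↦ Z (gridTime t n i))
    (η := fun i ω ↦ φ (W (gridTime t n (i + 1)) ω - W (gridTime t n i) ω))
    (fun i ↦ hZ _) (fun i ↦ hW.measurable_comp_grid_increment t n i hφ) (fun i ↦ hZ2 _)
    (fun i ↦ by
      have h1 := hφ2
      rw [← (hlaw i).map_eq] at h1
      exact h1.comp_of_map (hlaw i).aemeasurable)
    (fun i ↦ hW.indep_comp_grid_increment t n i hφ)
    (r := ∫ w, φ w ∂(gaussianReal 0 (t / (n + 1)))) (v := v)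
    (fun i ↦ (hlaw i).integral_comp hφ.aestronglyMeasurable)
    (fun i ↦ ((hlaw i).integral_comp (f := fun w ↦ φ w ^ 2)
      (hφ.pow_const 2).aestronglyMeasurable).trans_le hv) (n + 1)
  simpa using this

lemma adapted_gbm (hW : IsBrownianWrt 𝓕 W P) (μ σ : ℝ) : Adapted 𝓕 (gbm μ σ W) := fun t ↦
  (((hW.adapted t).const_mul σ).add_const _).exp

lemma integral_gbm_sq_le (hW : IsBrownianReal W P) (μ σ : ℝ) (s : ℝ≥0) :
    MemLp (gbm μ σ W s) 2 P ∧
      ∫ ω, gbm μ σ W s ω ^ 2 ∂P = Real.exp ((2 * μ + σ ^ 2) * s) := by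
  have hlaw := hW.hasLaw_eval s
  have hsq : ∀ ω, gbm μ σ W s ω ^ 2 =
      Real.exp (2 * σ * W s ω) * Real.exp (2 * (μ - σ ^ 2 / 2) * s) := fun ω ↦ by
    rw [gbm, ← Real.exp_nat_mul, ← Real.exp_add]
    push_cast
    ring_nf
  constructor
  · have h1 := memLp_two_exp_mul_gaussianReal σ s
    rw [← hlaw.map_eq] at h1
    have h2 := (h1.comp_of_map hlaw.aemeasurable).mul_const (Real.exp ((μ - σ ^ 2 / 2) * s))
    refine h2.ae_eq ?_
    filter_upwards with ω
    simp [gbm, Real.exp_add]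
  · simp_rw [hsq]
    rw [integral_mul_const]
    have := mgf_gaussianReal hlaw.map_eq (2 * σ)
    rw [mgf] at this
    rw [this, ← Real.exp_add]
    ring_nf

/-- The Euler sums of the explicit geometric Brownian motion converge in probability. -/
lemma tendstoInMeasure_eulerSum_gbm [IsProbabilityMeasure P] (hW : IsBrownianWrt 𝓕 W P)
    (μ σ : ℝ) (t : ℝ≥0) :
    TendstoInMeasure P (eulerSum μ σ W (gbm μ σ W) t) atTop (fun ω ↦ gbm μ σ W t ω - 1) := by
  obtain ⟨K, hK0, hK⟩ := exists_eulerRemainder_bound μ σ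
  have hW0 := hW.isBrownian.eval_zero_ae_eq_zero
  set M := Real.exp (|2 * μ + σ ^ 2| * t) with hM
  have hInt n : Integrable
      (fun ω ↦ (gbm μ σ W t ω - 1 - eulerSum μ σ W (gbm μ σ W) t n ω) ^ 2) P := by
    refine MemLp.integrable_sq (((integral_gbm_sq_le hW.isBrownian μ σ t).1.sub
      (memLp_const 1)).sub (memLp_finsetSum _ fun i _ ↦ ?_))
    refine memLp_two_mul_of_indepFun (integral_gbm_sq_le hW.isBrownian μ σ _).1 ?_
      (indepFun_of_indep_comap (adapted_gbm hW μ σ _)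
        (hW.indep_comp_grid_increment t n i (φ := fun w ↦ μ * (t / (n + 1)) + σ * w)
        (by fun_prop)))
    have hlaw := hasLaw_grid_increment hW.isBrownian t n i
    have h1 : MemLp (fun w : ℝ ↦ w) 2 (gaussianReal 0 (t / (n + 1))) := memLp_id_gaussianReal 2
    rw [← hlaw.map_eq] at h1
    exact (memLp_const (μ * ((t : ℝ) / (n + 1)))).add
      ((h1.comp_of_map hlaw.aemeasurable).const_mul σ)
  have hbound : ∀ᶠ n : ℕ in atTop,
      ∫ ω, (gbm μ σ W t ω - 1 - eulerSum μ σ W (gbm μ σ W) t n ω) ^ 2 ∂P ≤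
        2 * (K * (t / (n + 1)) * t + K ^ 2 * (t / (n + 1)) ^ 2 * t ^ 2) * M := by
    filter_upwards [(tendsto_mesh t).eventually_le_const one_pos] with n hn
    have hd : (t / (n + 1) : ℝ≥0) ≤ 1 := by
      rw [← NNReal.coe_le_coe]; push_cast; exact hn
    obtain ⟨hm, hv⟩ := hK _ hd
    have h1 : ∫ ω, (gbm μ σ W t ω - 1 - eulerSum μ σ W (gbm μ σ W) t n ω) ^ 2 ∂P =
        ∫ ω, (∑ i ∈ Finset.range (n + 1), gbm μ σ W (gridTime t n i) ω *
        eulerRemainder μ σ (t / (n + 1) : ℝ≥0)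
          (W (gridTime t n (i + 1)) ω - W (gridTime t n i) ω)) ^ 2 ∂P := by
      refine integral_congr_ae ?_
      filter_upwards [hW0] with ω hω
      rw [gbm_sub_one_sub_eulerSum hω]
    rw [h1]
    refine (hW.integral_sq_grid_sum_le (adapted_gbm hW μ σ)
      (fun s ↦ (integral_gbm_sq_le hW.isBrownian μ σ s).1) t n
      (measurable_eulerRemainder μ σ _) (memLp_two_eulerRemainder μ σ _) hv).trans ?_
    set d : ℝ := t / (n + 1) with hd'
    have hdc : ((t / (n + 1) : ℝ≥0) : ℝ) = d := by push_cast; rfl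
    have hnd : ((n : ℝ) + 1) * d = t := by rw [hd']; field_simp
    rw [hdc] at hm hv ⊢
    have hsum : ∑ i ∈ Finset.range (n + 1), ∫ ω, gbm μ σ W (gridTime t n i) ω ^ 2 ∂P
        ≤ (n + 1) * M := by
      calc _ ≤ ∑ i ∈ Finset.range (n + 1), M := by
            refine Finset.sum_le_sum fun i hi ↦ ?_
            rw [(integral_gbm_sq_le hW.isBrownian μ σ _).2, hM]
            refine Real.exp_le_exp.2 ?_
            calc (2 * μ + σ ^ 2) * (gridTime t n i) ≤ |2 * μ + σ ^ 2| * (gridTime t n i) := by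
                  gcongr; exact le_abs_self _
              _ ≤ _ := by
                  gcongr
                  exact gridTime_le (Finset.mem_range.1 hi).le
        _ = _ := by simp
    have hr2 : (∫ w, eulerRemainder μ σ d w ∂gaussianReal 0 (t / (n + 1))) ^ 2
        ≤ (K * d ^ 2) ^ 2 := by
      rw [← sq_abs]; gcongr
    calc _ ≤ 2 * (K * d ^ 2 + (n + 1) * (K * d ^ 2) ^ 2) * ((n + 1) * M) := by
          gcongr
      _ = 2 * (K * d * ((n + 1) * d) + K ^ 2 * d ^ 2 * ((n + 1) * d) ^ 2) * M := by ring
      _ = _ := by rw [hnd]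
  have hlim : Tendsto (fun n : ℕ ↦
      2 * (K * ((t : ℝ) / (n + 1)) * t + K ^ 2 * (t / (n + 1)) ^ 2 * t ^ 2) * M) atTop (𝓝 0) := by
    have hc : Continuous fun d : ℝ ↦ 2 * (K * d * t + K ^ 2 * d ^ 2 * t ^ 2) * M := by fun_prop
    have := (hc.tendsto 0).comp (tendsto_mesh t)
    simpa [Function.comp_def] using this
  rw [tendstoInMeasure_iff_measureReal_norm]
  intro ε hε
  have hlim' := hlim.div_const (ε ^ 2)
  rw [zero_div] at hlim'
  refine squeeze_zero' (Eventually.of_forall fun n ↦ measureReal_nonneg) ?_ hlim'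
  filter_upwards [hbound] with n hn
  rw [le_div_iff₀ (by positivity), mul_comm]
  refine le_trans ?_ hn
  have := mul_meas_ge_le_integral_of_nonneg (Eventually.of_forall fun ω ↦ sq_nonneg _) (hInt n)
    (ε ^ 2)
  refine le_trans (mul_le_mul_of_nonneg_left ?_ (sq_nonneg ε)) this
  refine measureReal_mono fun ω hω ↦ ?_
  simp only [Set.mem_ofPred_eq, Real.norm_eq_abs] at hω ⊢
  rw [abs_sub_comm] at hω
  rw [← sq_abs (gbm μ σ W t ω - 1 - _)]
  gcongr

lemma IsGeometricBrownianMotion.exists_seq_tendsto_eulerSum [IsProbabilityMeasure P]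
    (hW : IsBrownianWrt 𝓕 W P) (hX : IsGeometricBrownianMotion 𝓕 W P μ σ X) (t : ℝ≥0) :
    ∃ ns : ℕ → ℕ, ∀ᵐ ω ∂P,
      Tendsto (fun k ↦ eulerSum μ σ W (fun s ω ↦ X s ω - gbm μ σ W s ω) t (ns k) ω) atTop
        (𝓝 (X t ω - gbm μ σ W t ω)) := by
  obtain ⟨I, hI, heq⟩ := hX.eqn
  have hadapt : Adapted 𝓕 (fun s ω ↦ σ * X s ω) := fun s ↦ (hX.adapted s).const_mul σ
  have hcont : ∀ᵐ ω ∂P, Continuous (fun s ↦ σ * X s ω) := by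
    filter_upwards [hX.cont] with ω hω using hω.const_mul σ
  have hm := (hI t).2 _ (approximatesOn_gridProcess hadapt hcont t)
  obtain ⟨ns, hns, hlim⟩ := hm.exists_seq_tendsto_ae
  have hg := (tendstoInMeasure_eulerSum_gbm hW μ σ t).comp hns.tendsto_atTop
  obtain ⟨ms, hms, hglim⟩ := hg.exists_seq_tendsto_ae
  refine ⟨fun k ↦ ns (ms k), ?_⟩
  filter_upwards [hlim, hglim, heq t, hX.cont] with ω h1 h2 h3 h4
  have h5 := ((tendsto_grid_riemann_sum (h4.const_mul μ) t).comp
    hns.tendsto_atTop).comp hms.tendsto_atTop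
  have h6 := (h5.add (h1.comp hms.tendsto_atTop)).sub h2
  have e : X t ω - gbm μ σ W t ω =
      (∫ s in (0 : ℝ)..t, μ * X s.toNNReal ω) + I t ω - (gbm μ σ W t ω - 1) := by
    rw [h3]; ring
  rw [e]
  refine h6.congr fun k ↦ ?_
  simp only [Function.comp, gridProcess_integral, eulerSum]
  rw [← Finset.sum_add_distrib, ← Finset.sum_sub_distrib]
  exact Finset.sum_congr rfl fun i _ ↦ by ring

/-- The Fatou lemma for second moments. -/
lemma integral_sq_le_of_tendsto {f : ℕ → Ω → ℝ} {g : Ω → ℝ} {c : ℝ} (hc : 0 ≤ c)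
    (hf : ∀ n, Measurable (f n)) (hg : Measurable g)
    (hlim : ∀ᵐ ω ∂P, g ω = 0 ∨ Tendsto (fun n ↦ f n ω) atTop (𝓝 (g ω)))
    (hInt : ∀ n, Integrable (fun ω ↦ f n ω ^ 2) P) (hle : ∀ n, ∫ ω, f n ω ^ 2 ∂P ≤ c) :
    ∫ ω, g ω ^ 2 ∂P ≤ c := by
  rw [integral_eq_lintegral_of_nonneg_ae (Eventually.of_forall fun ω ↦ sq_nonneg _)
    (hg.pow_const 2).aestronglyMeasurable]
  refine ENNReal.toReal_le_of_le_ofReal hc ?_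
  calc ∫⁻ ω, ENNReal.ofReal (g ω ^ 2) ∂P
      ≤ ∫⁻ ω, liminf (fun n ↦ ENNReal.ofReal (f n ω ^ 2)) atTop ∂P := by
        refine lintegral_mono_ae ?_
        filter_upwards [hlim] with ω hω
        rcases hω with h | h
        · simp [h]
        · have := (ENNReal.continuous_ofReal.tendsto _).comp (h.pow 2)
          exact this.liminf_eq.ge
    _ ≤ liminf (fun n ↦ ∫⁻ ω, ENNReal.ofReal (f n ω ^ 2) ∂P) atTop :=
        lintegral_liminf_le fun n ↦ ((hf n).pow_const 2).ennreal_ofReal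
    _ ≤ ENNReal.ofReal c := by
        refine liminf_le_of_frequently_le' (Frequently.of_forall fun n ↦ ?_)
        rw [← ofReal_integral_eq_lintegral_ofReal (hInt n)
          (Eventually.of_forall fun ω ↦ sq_nonneg _)]
        exact ENNReal.ofReal_le_ofReal (hle n)

/-- The event that a process stays in `[-N, N]` up to time `s`, tested on a countable set. -/
def stayEvent (D : ℝ≥0 → Ω → ℝ) (N : ℝ) (s : ℝ≥0) : Set Ω :=
  {ω | ∀ n, |D (min (TopologicalSpace.denseSeq ℝ≥0 n) s) ω| ≤ N}

lemma measurableSet_stayEvent {D : ℝ≥0 → Ω → ℝ} (hD : Adapted 𝓕 D) (N : ℝ) (s : ℝ≥0) :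
    MeasurableSet[𝓕 s] (stayEvent D N s) := by
  have : stayEvent D N s =
      ⋂ n, {ω | |D (min (TopologicalSpace.denseSeq ℝ≥0 n) s) ω| ≤ N} := by
    ext; simp [stayEvent]
  rw [this]
  refine MeasurableSet.iInter fun n ↦ ?_
  have h := (hD (min (TopologicalSpace.denseSeq ℝ≥0 n) s)).mono (𝓕.mono (min_le_right _ _)) le_rfl
  exact h (measurableSet_le (measurable_id.abs) measurable_const : MeasurableSet {x : ℝ | |x| ≤ N})

lemma abs_le_of_mem_stayEvent {D : ℝ≥0 → Ω → ℝ} {N : ℝ} {s : ℝ≥0} {ω : Ω}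
    (h : ω ∈ stayEvent D N s) : |D s ω| ≤ N := by
  obtain ⟨n, hn⟩ := (TopologicalSpace.denseRange_denseSeq ℝ≥0).exists_mem_open
    (isOpen_Ioi (a := s)) ⟨s + 1, by simp⟩
  simpa [min_eq_right (Set.mem_Ioi.1 hn).le] using h n

lemma mem_stayEvent_iff {D : ℝ≥0 → Ω → ℝ} {N : ℝ} {s : ℝ≥0} {ω : Ω} (hc : Continuous (D · ω)) :
    ω ∈ stayEvent D N s ↔ ∀ u ≤ s, |D u ω| ≤ N := by
  refine ⟨fun h u hu ↦ ?_, fun h n ↦ h _ (min_le_right _ _)⟩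
  have hcl : IsClosed {u : ℝ≥0 | |D (min u s) ω| ≤ N} :=
    isClosed_le (hc.comp (by fun_prop : Continuous fun u : ℝ≥0 ↦ min u s)).abs continuous_const
  have huniv := (TopologicalSpace.denseRange_denseSeq ℝ≥0).closure_range
  have : u ∈ {u : ℝ≥0 | |D (min u s) ω| ≤ N} := by
    refine hcl.closure_subset_iff.2 (Set.range_subset_iff.2 h) ?_
    rw [huniv]; trivial
  simpa [min_eq_left hu] using this

lemma mesh_mul_sum_exp_le {L : ℝ} (hL : 0 < L) (t : ℝ≥0) (n : ℕ) :
    (t / (n + 1) : ℝ) * ∑ i ∈ Finset.range (n + 1), Real.exp (L * gridTime t n i)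
      ≤ Real.exp (L * t) / L := by
  rw [le_div_iff₀ hL, mul_comm, ← mul_assoc, Finset.mul_sum]
  calc ∑ i ∈ Finset.range (n + 1), L * (t / (n + 1) : ℝ) * Real.exp (L * gridTime t n i)
      ≤ ∑ i ∈ Finset.range (n + 1),
        (Real.exp (L * gridTime t n (i + 1)) - Real.exp (L * gridTime t n i)) := by
        refine Finset.sum_le_sum fun i _ ↦ ?_
        rw [gridTime_succ]
        push_cast
        rw [mul_add, Real.exp_add]
        nlinarith [Real.add_one_le_exp (L * (t / (n + 1) : ℝ)),
          Real.exp_pos (L * gridTime t n i)]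
    _ = Real.exp (L * t) - 1 := by
        rw [Finset.sum_range_sub (fun i ↦ Real.exp (L * gridTime t n i)), gridTime_last,
          gridTime_zero]
        simp
    _ ≤ _ := by linarith

/-- A process that is the limit of its own Euler sums vanishes. -/
lemma ae_eq_zero_of_tendsto_eulerSum [IsProbabilityMeasure P] (hW : IsBrownianWrt 𝓕 W P)
    {D : ℝ≥0 → Ω → ℝ} (hD : Adapted 𝓕 D) (hc : ∀ᵐ ω ∂P, Continuous (D · ω))
    (hlim : ∀ t, ∃ ns : ℕ → ℕ, ∀ᵐ ω ∂P,
      Tendsto (fun k ↦ eulerSum μ σ W D t (ns k) ω) atTop (𝓝 (D t ω))) (T : ℝ≥0) :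
    ∀ᵐ ω ∂P, D T ω = 0 := by
  let E : ℕ → ℝ≥0 → Ω → ℝ := fun N s ↦ (stayEvent D N s).indicator (D s)
  have hEad N : Adapted 𝓕 (E N) := fun s ↦ (hD s).indicator (measurableSet_stayEvent hD N s)
  have hEm N s : Measurable (E N s) := (hEad N s).mono (𝓕.le s) le_rfl
  have hEle N s ω : |E N s ω| ≤ N := by
    by_cases h : ω ∈ stayEvent D N s
    · simpa [E, h] using abs_le_of_mem_stayEvent h
    · simp [E, h]
  have hE2 N s : MemLp (E N s) 2 P :=
    MemLp.of_bound (hEm N s).aestronglyMeasurable N (Eventually.of_forall (hEle N s))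
  set κ : ℝ := 2 * (2 * μ ^ 2 * T + σ ^ 2) with hκ
  have hκ0 : 0 ≤ κ := by positivity
  set L : ℝ := 2 * κ + 1 with hL
  have hL0 : 0 < L := by positivity
  have hstep (N : ℕ) (M : ℝ) (hM0 : 0 ≤ M)
      (hM : ∀ s ≤ T, ∫ ω, E N s ω ^ 2 ∂P ≤ M * Real.exp (L * s)) :
      ∀ s ≤ T, ∫ ω, E N s ω ^ 2 ∂P ≤ M / 2 * Real.exp (L * s) := by
    intro s hs
    obtain ⟨ns, hns⟩ := hlim s
    have hφ2 (n : ℕ) : MemLp (fun w : ℝ ↦ μ * ((s : ℝ) / (n + 1)) + σ * w) 2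
        (gaussianReal 0 (s / (n + 1))) := by
      have h1 : MemLp (fun w : ℝ ↦ w) 2 (gaussianReal 0 (s / (n + 1))) := memLp_id_gaussianReal 2
      exact (memLp_const (μ * ((s : ℝ) / (n + 1)))).add (h1.const_mul σ)
    refine integral_sq_le_of_tendsto (f := fun k ↦ eulerSum μ σ W (E N) s (ns k)) (by positivity)
      (fun k ↦ ?_) (hEm N s) ?_ (fun k ↦ ?_) (fun k ↦ ?_)
    · refine Finset.measurable_fun_sum _ fun i _ ↦ (hEm N _).mul ?_
      have hWm t : Measurable (W t) := (hW.adapted t).mono (𝓕.le t) le_rfl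
      exact (((hWm _).sub (hWm _)).const_mul σ).const_add _
    · filter_upwards [hns, hc] with ω h1 h2
      by_cases h : ω ∈ stayEvent D N s
      · right
        have h3 : E N s ω = D s ω := by simp [E, h]
        rw [h3]
        refine h1.congr fun k ↦ Finset.sum_congr rfl fun i hi ↦ ?_
        have h4 : ω ∈ stayEvent D N (gridTime s (ns k) i) := by
          rw [mem_stayEvent_iff h2] at h ⊢
          exact fun u hu ↦ h u (hu.trans (gridTime_le (Finset.mem_range.1 hi).le))
        simp [E, h4]
      · left
        simp [E, h]
    · refine MemLp.integrable_sq (memLp_finsetSum _ fun i _ ↦ ?_)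
      have hlaw := hasLaw_grid_increment hW.isBrownian s (ns k) i
      refine memLp_two_mul_of_indepFun (hE2 N _) ?_
        (indepFun_of_indep_comap (hEad N _) (hW.indep_comp_grid_increment s (ns k) i
        (φ := fun w ↦ μ * (s / ((ns k : ℕ) + 1)) + σ * w) (by fun_prop)))
      have h1 := hφ2 (ns k)
      rw [← hlaw.map_eq] at h1
      exact h1.comp_of_map hlaw.aemeasurable
    · set n := ns k with hn
      set d : ℝ := (s : ℝ) / (n + 1) with hd
      have hd0 : 0 ≤ d := by positivity
      have hnd : ((n : ℝ) + 1) * d = s := by rw [hd]; field_simp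
      have hds : d ≤ T := by
        have : (s : ℝ) ≤ T := hs
        refine le_trans ?_ this
        rw [hd]
        exact div_le_self s.coe_nonneg (by linarith [n.cast_nonneg (α := ℝ)])
      have hid : Integrable (fun w : ℝ ↦ w) (gaussianReal 0 (s / (n + 1))) :=
        (memLp_id_gaussianReal 1).integrable (by simp)
      have hsqi : Integrable (fun w : ℝ ↦ w ^ 2) (gaussianReal 0 (s / (n + 1))) :=
        (memLp_id_gaussianReal 2).integrable_sq
      have hr : ∫ w, (μ * d + σ * w) ∂(gaussianReal 0 (s / (n + 1))) = μ * d := by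
        rw [integral_add (integrable_const _) (hid.const_mul σ), integral_const_mul σ,
          integral_id_gaussianReal]
        simp
      have hvar : ∫ w, w ^ 2 ∂(gaussianReal 0 (s / (n + 1))) = d := by
        have h1 := variance_of_integral_eq_zero (X := fun w : ℝ ↦ w) aemeasurable_id
          (integral_id_gaussianReal (μ := 0) (v := s / (n + 1)))
        rw [variance_fun_id_gaussianReal] at h1
        rw [← h1, hd]
        push_cast
        rfl
      have hv : ∫ w, (μ * d + σ * w) ^ 2 ∂(gaussianReal 0 (s / (n + 1)))
          = μ ^ 2 * d ^ 2 + σ ^ 2 * d := by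
        have : ∀ w : ℝ, (μ * d + σ * w) ^ 2 =
          μ ^ 2 * d ^ 2 + 2 * μ * d * σ * w + σ ^ 2 * w ^ 2 := fun w ↦ by ring
        simp_rw [this]
        rw [integral_add (f := fun w ↦ μ ^ 2 * d ^ 2 + 2 * μ * d * σ * w)
          ((integrable_const _).add (hid.const_mul _)) (hsqi.const_mul _),
          integral_add (integrable_const _) (hid.const_mul _), integral_const_mul (σ ^ 2), hvar,
          integral_const_mul (2 * μ * d * σ), integral_id_gaussianReal]
        simp
      have := hW.integral_sq_grid_sum_le (hEad N) (hE2 N) s n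
        (φ := fun w ↦ μ * d + σ * w) (by fun_prop) (hφ2 n) hv.le
      rw [hr] at this
      refine this.trans ?_
      have hsum : ∑ i ∈ Finset.range (n + 1), ∫ ω, E N (gridTime s n i) ω ^ 2 ∂P
          ≤ M * ∑ i ∈ Finset.range (n + 1), Real.exp (L * gridTime s n i) := by
        rw [Finset.mul_sum]
        exact Finset.sum_le_sum fun i hi ↦
          hM _ ((gridTime_le (Finset.mem_range.1 hi).le).trans hs)
      have hexp := mesh_mul_sum_exp_le hL0 s n
      rw [← hd] at hexp
      have hs' : (s : ℝ) ≤ T := hs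
      calc _ ≤ 2 * (μ ^ 2 * d ^ 2 + σ ^ 2 * d + (n + 1) * (μ * d) ^ 2) *
            (M * ∑ i ∈ Finset.range (n + 1), Real.exp (L * gridTime s n i)) := by gcongr
        _ = 2 * (μ ^ 2 * d + σ ^ 2 + μ ^ 2 * ((n + 1) * d)) * M *
            (d * ∑ i ∈ Finset.range (n + 1), Real.exp (L * gridTime s n i)) := by ring
        _ ≤ 2 * (μ ^ 2 * T + σ ^ 2 + μ ^ 2 * T) * M * (Real.exp (L * s) / L) := by
            rw [hnd]; gcongr
        _ = M * Real.exp (L * s) * (κ / L) := by rw [hκ]; ring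
        _ ≤ M * Real.exp (L * s) * (1 / 2) := by
            refine mul_le_mul_of_nonneg_left ?_ (by positivity)
            rw [div_le_div_iff₀ hL0 two_pos]
            linarith
        _ = _ := by ring
  have hiter (N m : ℕ) : ∀ s ≤ T, ∫ ω, E N s ω ^ 2 ∂P ≤
      N ^ 2 * (1 / 2) ^ m * Real.exp (L * s) := by
    induction m with
    | zero =>
      intro s _
      calc ∫ ω, E N s ω ^ 2 ∂P ≤ ∫ ω, (N : ℝ) ^ 2 ∂P := by
            refine integral_mono (hE2 N s).integrable_sq (integrable_const _) fun ω ↦ ?_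
            simp only
            rw [← sq_abs]
            have := hEle N s ω
            gcongr
        _ = N ^ 2 * 1 := by simp
        _ ≤ _ := by
            simp only [pow_zero, mul_one]
            exact le_mul_of_one_le_right (by positivity) (Real.one_le_exp (by positivity))
    | succ m ih =>
      intro s hs
      refine (hstep N _ (by positivity) ih s hs).trans_eq ?_
      rw [pow_succ]; ring
  have hzero (N : ℕ) : ∀ᵐ ω ∂P, E N T ω = 0 := by
    have h0 : ∫ ω, E N T ω ^ 2 ∂P ≤ 0 := by
      have hl : Tendsto (fun m : ℕ ↦ (N : ℝ) ^ 2 * (1 / 2) ^ m * Real.exp (L * T)) atTop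
          (𝓝 ((N : ℝ) ^ 2 * 0 * Real.exp (L * T))) :=
        ((tendsto_pow_atTop_nhds_zero_of_lt_one (by norm_num) (by norm_num)).const_mul _).mul_const _
      rw [mul_zero, zero_mul] at hl
      exact ge_of_tendsto' hl fun m ↦ hiter N m T le_rfl
    have h1 := (integral_eq_zero_iff_of_nonneg (fun ω ↦ sq_nonneg (E N T ω))
      (hE2 N T).integrable_sq).1 (le_antisymm h0 (integral_nonneg fun ω ↦ sq_nonneg _))
    filter_upwards [h1] with ω hω
    simpa using hω
  filter_upwards [ae_all_iff.2 hzero, hc] with ω h1 h2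
  obtain ⟨C, hC⟩ := (isCompact_Icc (a := (0 : ℝ≥0)) (b := T)).exists_bound_of_continuousOn
    h2.continuousOn
  obtain ⟨N, hN⟩ := exists_nat_ge C
  have hmem : ω ∈ stayEvent D N T := by
    rw [mem_stayEvent_iff h2]
    exact fun u hu ↦ (hC u ⟨zero_le, hu⟩).trans hN
  simpa [E, hmem] using h1 N

/-- A solution of the equation of geometric Brownian motion is the explicit one. -/
theorem IsGeometricBrownianMotion.ae_eq_gbm [IsProbabilityMeasure P]
    (hW : IsBrownianWrt 𝓕 W P) (hX : IsGeometricBrownianMotion 𝓕 W P μ σ X) :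
    ∀ᵐ ω ∂P, ∀ t, X t ω = gbm μ σ W t ω := by
  have hcg : ∀ᵐ ω ∂P, Continuous (gbm μ σ W · ω) := by
    filter_upwards [hW.isBrownian.cont] with ω hω
    unfold gbm
    fun_prop
  have hpt t : ∀ᵐ ω ∂P, X t ω - gbm μ σ W t ω = 0 := by
    refine ae_eq_zero_of_tendsto_eulerSum (μ := μ) (σ := σ) hW
      (D := fun s ω ↦ X s ω - gbm μ σ W s ω)
      (fun s ↦ (hX.adapted s).sub (adapted_gbm hW μ σ s)) ?_
      (hX.exists_seq_tendsto_eulerSum hW) t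
    filter_upwards [hX.cont, hcg] with ω h1 h2 using h1.sub h2
  have hcount : ∀ᵐ ω ∂P, ∀ n, X (TopologicalSpace.denseSeq ℝ≥0 n) ω =
      gbm μ σ W (TopologicalSpace.denseSeq ℝ≥0 n) ω :=
    ae_all_iff.2 fun n ↦ (hpt _).mono fun ω h ↦ sub_eq_zero.1 h
  filter_upwards [hcount, hX.cont, hcg] with ω h1 h2 h3
  have := (TopologicalSpace.denseRange_denseSeq ℝ≥0).equalizer h2 h3 (funext h1)
  exact fun t ↦ congrFun this t

end Uniqueness

/-! ### Crossing of a line by Brownian motion -/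

section LineCrossing

variable {Ω : Type*} {mΩ : MeasurableSpace Ω} {P : Measure Ω} {W : ℝ≥0 → Ω → ℝ}

lemma lintegral_exp_gaussianReal (θ : ℝ) (d : ℝ≥0) :
    ∫⁻ w, ENNReal.ofReal (Real.exp (θ * w - θ ^ 2 / 2 * d)) ∂(gaussianReal 0 d) = 1 := by
  have hInt : Integrable (fun w ↦ Real.exp (θ * w - θ ^ 2 / 2 * d)) (gaussianReal 0 d) := by
    simp_rw [Real.exp_sub]
    exact (integrable_exp_mul_gaussianReal θ).div_const _
  rw [← ofReal_integral_eq_lintegral_ofReal hInt (Eventually.of_forall fun w ↦ (Real.exp_pos _).le)]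
  simp_rw [Real.exp_sub]
  rw [integral_div]
  have h : ∫ w, Real.exp (θ * w) ∂(gaussianReal 0 d) = Real.exp (d * θ ^ 2 / 2) := by
    have := congrFun (mgf_id_gaussianReal (μ := 0) (v := d)) θ
    simpa [mgf] using this
  rw [h, ← Real.exp_sub]
  ring_nf
  simp

lemma ProbabilityTheory.IsPreBrownianReal.lintegral_exp_increment (hW : IsPreBrownianReal W P) (θ : ℝ) {s t : ℝ≥0}
    (hst : s ≤ t) :
    ∫⁻ ω, ENNReal.ofReal (Real.exp (θ * (W t ω - W s ω) - θ ^ 2 / 2 * (t - s))) ∂P = 1 := by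
  have hlaw := hW.hasLaw_sub t s
  have hd : nndist t.1 s.1 = t - s := by
    ext
    rw [coe_nndist, Real.dist_eq, NNReal.coe_sub hst, abs_of_nonneg]
    · rfl
    · exact sub_nonneg.2 hst
  rw [hd] at hlaw
  have := hlaw.lintegral_comp (f := fun w ↦ ENNReal.ofReal (Real.exp (θ * w - θ ^ 2 / 2 *
    (t - s : ℝ≥0)))) (by fun_prop)
  rw [lintegral_exp_gaussianReal, NNReal.coe_sub hst] at this
  exact this

/-- The exponential martingale bounds from above the probability of having crossed a line. -/
lemma ProbabilityTheory.IsPreBrownianReal.mul_measure_cross_le (hW : IsPreBrownianReal W P)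
    (hWm : ∀ t, Measurable (W t)) {a c : ℝ} (ha : 0 ≤ a) (F : Finset ℝ≥0) :
    ∀ t, (∀ s ∈ F, s ≤ t) → ENNReal.ofReal (Real.exp (2 * a * c)) *
        P {ω | ∃ s ∈ F, c + a * s ≤ W s ω} ≤
      ∫⁻ ω in {ω | ∃ s ∈ F, c + a * s ≤ W s ω},
        ENNReal.ofReal (Real.exp (2 * a * W t ω - (2 * a) ^ 2 / 2 * t)) ∂P := by
  have hmeas (F : Finset ℝ≥0) : MeasurableSet {ω | ∃ s ∈ F, c + a * s ≤ W s ω} := by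
    have : {ω | ∃ s ∈ F, c + a * s ≤ W s ω} = ⋃ s ∈ F, {ω | c + a * s ≤ W s ω} := by
      ext; simp
    rw [this]
    exact F.measurableSet_biUnion fun s _ ↦ measurableSet_le measurable_const (hWm s)
  induction F using Finset.induction_on_max with
  | empty => simp
  | insert m F hm ih =>
    intro t ht
    have hmt : m ≤ t := ht m (Finset.mem_insert_self _ _)
    set CF := {ω | ∃ s ∈ F, c + a * s ≤ W s ω} with hCF
    set N := {ω | c + a * m ≤ W m ω} \ CF with hN
    have hunion : {ω | ∃ s ∈ insert m F, c + a * s ≤ W s ω} = CF ∪ N := by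
      ext ω
      simp only [Finset.mem_insert, exists_eq_or_imp, Set.mem_ofPred_eq, Set.mem_union, hN, hCF,
        Set.mem_sdiff]
      by_cases h : ∃ s ∈ F, c + a * s ≤ W s ω <;> simp [h]
    have hdisj : Disjoint CF N := Set.disjoint_sdiff_right
    have hNm : MeasurableSet N :=
      (measurableSet_le measurable_const (hWm m)).diff (hmeas F)
    rw [hunion, measure_union hdisj hNm, lintegral_union hNm hdisj, mul_add]
    refine add_le_add (ih t fun s hs ↦ ht s (Finset.mem_insert_of_mem hs)) ?_
    -- the part of the path after time `m` is independent of the new crossing event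
    have h𝓜le := (measurable_pi_lambda (fun ω (u : Set.Iic m) ↦ W u ω) fun u ↦ hWm u).comap_le
    have h𝓢le := (measurable_pi_lambda (fun ω (u : ℝ≥0) ↦ W (m + u) ω - W m ω)
      fun u ↦ (hWm _).sub (hWm _)).comap_le
    set 𝓜 : MeasurableSpace Ω :=
      MeasurableSpace.comap (fun ω (u : Set.Iic m) ↦ W u ω) inferInstance
    set 𝓢 : MeasurableSpace Ω :=
      MeasurableSpace.comap (fun ω (u : ℝ≥0) ↦ W (m + u) ω - W m ω) inferInstance
    have hWM (s : ℝ≥0) (hs : s ≤ m) : Measurable[𝓜] (W s) :=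
      (measurable_pi_apply (X := fun _ : Set.Iic m ↦ ℝ) ⟨s, hs⟩).comp
        (comap_measurable fun ω (u : Set.Iic m) ↦ W u ω)
    have hNM : MeasurableSet[𝓜] N := by
      have e : N = {ω | c + a * m ≤ W m ω} \ ⋃ s ∈ F, {ω | c + a * s ≤ W s ω} := by
        rw [hN, hCF]; ext; simp
      rw [e]
      refine MeasurableSet.diff (measurableSet_le measurable_const (hWM m le_rfl)) ?_
      exact F.measurableSet_biUnion fun s hs ↦
        measurableSet_le measurable_const (hWM s (hm s hs).le)
    have hincr : Measurable[𝓢] (fun ω ↦ W t ω - W m ω) := by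
      have h1 := (measurable_pi_apply (X := fun _ : ℝ≥0 ↦ ℝ) (t - m)).comp
        (comap_measurable fun ω (u : ℝ≥0) ↦ W (m + u) ω - W m ω)
      simpa [Function.comp_def, add_tsub_cancel_of_le hmt] using h1
    have hind := lintegral_mul_eq_lintegral_mul_lintegral_of_independent_measurableSpace
      (μ := P) (Mf := 𝓜) (Mg := 𝓢)
      (f := N.indicator fun ω ↦ ENNReal.ofReal (Real.exp (2 * a * W m ω - (2 * a) ^ 2 / 2 * m)))
      (g := fun ω ↦ ENNReal.ofReal
        (Real.exp (2 * a * (W t ω - W m ω) - (2 * a) ^ 2 / 2 * (t - m))))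
      h𝓜le h𝓢le
      ((IndepFun_iff_Indep _ _ _).1 (hW.indepFun_shift m)).symm
      (Measurable.indicator
        (((((hWM m le_rfl).const_mul (2 * a)).sub_const _).exp).ennreal_ofReal) hNM)
      ((((hincr.const_mul (2 * a)).sub_const _).exp).ennreal_ofReal)
    rw [hW.lintegral_exp_increment (2 * a) hmt, mul_one] at hind
    have hfact : ∫⁻ ω in N, ENNReal.ofReal (Real.exp (2 * a * W t ω - (2 * a) ^ 2 / 2 * t)) ∂P =
        ∫⁻ ω in N, ENNReal.ofReal (Real.exp (2 * a * W m ω - (2 * a) ^ 2 / 2 * m)) ∂P := by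
      rw [← lintegral_indicator hNm, ← lintegral_indicator hNm, ← hind]
      refine lintegral_congr fun ω ↦ ?_
      by_cases hω : ω ∈ N
      · simp only [Set.indicator_of_mem hω]
        rw [← ENNReal.ofReal_mul (Real.exp_pos _).le, ← Real.exp_add]
        ring_nf
      · simp [Set.indicator_of_notMem hω]
    rw [hfact, ← setLIntegral_const]
    refine setLIntegral_mono' hNm fun ω hω ↦ ENNReal.ofReal_le_ofReal (Real.exp_le_exp.2 ?_)
    have h1 : c + a * m ≤ W m ω := hω.1
    nlinarith [mul_le_mul_of_nonneg_left h1 ha]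

/-- The probability that Brownian motion crosses the line `c + a s` is at most `exp (-2 a c)`. -/
lemma ProbabilityTheory.IsPreBrownianReal.measure_cross_line_le (hW : IsPreBrownianReal W P)
    (hWm : ∀ t, Measurable (W t)) {a : ℝ} (c : ℝ) (ha : 0 ≤ a) (q : ℕ → ℝ≥0) :
    P {ω | ∃ n, c + a * q n ≤ W (q n) ω} ≤ ENNReal.ofReal (Real.exp (-(2 * a * c))) := by
  have hfin (F : Finset ℝ≥0) :
      P {ω | ∃ s ∈ F, c + a * s ≤ W s ω} ≤ ENNReal.ofReal (Real.exp (-(2 * a * c))) := by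
    have h1 := hW.mul_measure_cross_le hWm (c := c) ha F (F.sup id)
      fun s hs ↦ Finset.le_sup (f := id) hs
    have h2 : ∫⁻ ω, ENNReal.ofReal
        (Real.exp (2 * a * W (F.sup id) ω - (2 * a) ^ 2 / 2 * (F.sup id : ℝ≥0))) ∂P = 1 := by
      have h3 := (hW.hasLaw_eval (F.sup id)).lintegral_comp (f := fun w ↦ ENNReal.ofReal
        (Real.exp (2 * a * w - (2 * a) ^ 2 / 2 * (F.sup id : ℝ≥0)))) (by fun_prop)
      rw [lintegral_exp_gaussianReal] at h3
      exact h3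
    have h4 := h1.trans ((setLIntegral_le_lintegral _ _).trans h2.le)
    rw [Real.exp_neg, ENNReal.ofReal_inv_of_pos (Real.exp_pos _), ENNReal.le_inv_iff_mul_le, mul_comm]
    exact h4
  have hU : {ω | ∃ n, c + a * q n ≤ W (q n) ω} =
      ⋃ k : ℕ, {ω | ∃ s ∈ (Finset.range k).image q, c + a * s ≤ W s ω} := by
    ext ω
    simp only [Set.mem_ofPred_eq, Set.mem_iUnion, Finset.mem_image, Finset.mem_range]
    constructor
    · rintro ⟨n, hn⟩
      exact ⟨n + 1, q n, ⟨n, Nat.lt_succ_self n, rfl⟩, hn⟩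
    · rintro ⟨k, s, ⟨n, -, rfl⟩, h⟩
      exact ⟨n, h⟩
  rw [hU, Monotone.measure_iUnion]
  · exact iSup_le fun k ↦ hfin _
  · rintro k l hkl ω ⟨s, hs, h⟩
    exact ⟨s, Finset.image_subset_image (Finset.range_subset_range.2 hkl) hs, h⟩

/-- Gaussian tail of the maximum of `|W|` over `[0, T]`. -/
lemma ProbabilityTheory.IsPreBrownianReal.measure_exists_abs_ge_le (hW : IsPreBrownianReal W P)
    (hWm : ∀ t, Measurable (W t)) {T : ℝ≥0} (hT : 0 < T) {x : ℝ} (hx : 0 ≤ x) {q : ℕ → ℝ≥0}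
    (hq : ∀ n, q n ≤ T) :
    P {ω | ∃ n, x ≤ |W (q n) ω|} ≤ 2 * ENNReal.ofReal (Real.exp (-(x ^ 2 / (2 * T)))) := by
  have hT' : (0 : ℝ) < T := hT
  have ha : 0 ≤ x / (2 * T) := by positivity
  have hline n : x / 2 + x / (2 * T) * q n ≤ x := by
    have h1 : (q n : ℝ) ≤ T := hq n
    calc x / 2 + x / (2 * T) * q n ≤ x / 2 + x / (2 * T) * T := by gcongr
      _ = x := by field_simp; ring
  have e : 2 * (x / (2 * T)) * (x / 2) = x ^ 2 / (2 * T) := by ring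
  have h1 := hW.measure_cross_line_le hWm (x / 2) ha q
  have h2 := hW.neg.measure_cross_line_le (fun t ↦ (hWm t).neg) (x / 2) ha q
  rw [e] at h1 h2
  rw [two_mul]
  refine le_trans ?_ (add_le_add h1 h2)
  refine (measure_mono ?_).trans (measure_union_le _ _)
  rintro ω ⟨n, hn⟩
  rcases le_abs'.1 hn with h | h
  · right
    exact ⟨n, by simpa using (hline n).trans (by linarith)⟩
  · left
    exact ⟨n, (hline n).trans h⟩

end LineCrossing

/-! ### The Brownian bridge -/

section Bridge

variable {Ω : Type*} {mΩ : MeasurableSpace Ω} {P : Measure Ω} {W : ℝ≥0 → Ω → ℝ}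

/-- The bridge `W_t - (t / T) W_T` from `0` to `0` on `[0, T]`. -/
noncomputable def bridge (W : ℝ≥0 → Ω → ℝ) (T t : ℝ≥0) (ω : Ω) : ℝ :=
  W t ω - t / T * W T ω

lemma measurable_bridge (hWm : ∀ t, Measurable (W t)) (T t : ℝ≥0) : Measurable (bridge W T t) :=
  (hWm t).sub ((hWm T).const_mul _)

lemma bridge_self (W : ℝ≥0 → Ω → ℝ) {T : ℝ≥0} (hT : 0 < T) (ω : Ω) : bridge W T T ω = 0 := by
  have : (T : ℝ) ≠ 0 := by positivity
  simp [bridge, div_self this]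

lemma ProbabilityTheory.IsPreBrownianReal.memLp_two (hW : IsPreBrownianReal W P) (t : ℝ≥0) :
    MemLp (W t) 2 P :=
  (hW.isGaussianProcess.hasGaussianLaw_eval t).memLp_two

/-- The bridge is independent of the terminal value. -/
lemma ProbabilityTheory.IsPreBrownianReal.indepFun_bridge (hW : IsPreBrownianReal W P)
    {T : ℝ≥0} (hT : 0 < T) {q : ℕ → ℝ≥0} (hq : ∀ n, q n ≤ T) :
    IndepFun (fun ω n ↦ bridge W T (q n) ω) (W T) P := by
  have := hW.isGaussianProcess.isProbabilityMeasure
  have hT' : (T : ℝ) ≠ 0 := by positivity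
  have h : IndepFun (fun ω n ↦ bridge W T (q n) ω) (fun ω (_ : Unit) ↦ W T ω) P := by
    refine IsGaussianProcess.indepFun_of_covariance_eq_zero
      (X := fun n ω ↦ bridge W T (q n) ω) (Y := fun (_ : Unit) ω ↦ W T ω) ?_ ?_ ?_ ?_
    · refine hW.isGaussianProcess.of_isGaussianProcess ?_
      rintro (n | u)
      · exact ⟨{q n, T},
          { toFun x := x ⟨q n, by simp⟩ - q n / T * x ⟨T, by simp⟩
            map_add' x y := by simp; ring
            map_smul' c x := by simp; ring }, by simp [bridge]⟩
      · exact ⟨{T},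
          { toFun x := x ⟨T, by simp⟩
            map_add' x y := by simp
            map_smul' c x := by simp }, by simp⟩
    · exact fun n ↦ (hW.aemeasurable _).sub ((hW.aemeasurable _).const_mul _)
    · exact fun _ ↦ hW.aemeasurable _
    · intro n _
      unfold bridge
      rw [covariance_fun_sub_left (hW.memLp_two _) ((hW.memLp_two _).const_mul _)
        (hW.memLp_two _), covariance_const_mul_left, hW.covariance_fun_eval,
        hW.covariance_fun_eval, min_eq_left (hq n), min_self]
      field_simp
      ring
  exact h.comp measurable_id (measurable_pi_apply ())

/-- The Brownian motion on `[0, ∞)` obtained from a bridge by scaling space and time. -/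
lemma ProbabilityTheory.IsPreBrownianReal.scaled_bridge (hW : IsPreBrownianReal W P)
    {T : ℝ≥0} (hT : 0 < T) :
    IsPreBrownianReal (fun s ω ↦ (((s : ℝ) + T) / T) * bridge W T (s * T / (s + T)) ω) P := by
  have := hW.isGaussianProcess.isProbabilityMeasure
  have hT' : (T : ℝ) ≠ 0 := by positivity
  refine IsGaussianProcess.isPreBrownianReal_of_covariance ?_ (fun t ↦ ?_) (fun s t hst ↦ ?_)
  · refine hW.isGaussianProcess.of_isGaussianProcess fun s ↦ ?_
    exact ⟨{s * T / (s + T), T},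
      { toFun x := (((s : ℝ) + T) / T) * (x ⟨s * T / (s + T), by simp⟩ -
          (s * T / (s + T) : ℝ≥0) / T * x ⟨T, by simp⟩)
        map_add' x y := by simp; ring
        map_smul' c x := by simp; ring }, by simp [bridge]⟩
  · unfold bridge
    rw [integral_const_mul, integral_sub (hW.integrable_eval _)
      ((hW.integrable_eval _).const_mul _), integral_const_mul, hW.integral_eval,
      hW.integral_eval]
    simp
  · have hle (s : ℝ≥0) : s * T / (s + T) ≤ T := by
      rw [div_le_iff₀ (by positivity), mul_comm]
      gcongr
      exact le_self_add
    have hmono : s * T / (s + T) ≤ t * T / (t + T) := by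
      rw [div_le_div_iff₀ (by positivity) (by positivity)]
      have h1 : s * T * (t + T) = s * t * T + s * (T * T) := by ring
      have h2 : t * T * (s + T) = s * t * T + t * (T * T) := by ring
      rw [h1, h2]
      gcongr
    have m (u : ℝ≥0) : MemLp (W u) 2 P := hW.memLp_two u
    have mb (u : ℝ≥0) : MemLp (fun ω ↦ W u ω - u / T * W T ω) 2 P := (m u).sub ((m T).const_mul _)
    unfold bridge
    rw [covariance_const_mul_left, covariance_const_mul_right,
      covariance_fun_sub_left (m _) ((m _).const_mul _) (mb _),
      covariance_fun_sub_right (m _) (m _) ((m _).const_mul _),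
      covariance_fun_sub_right ((m _).const_mul _) (m _) ((m _).const_mul _),
      covariance_const_mul_left, covariance_const_mul_left, covariance_const_mul_right,
      covariance_const_mul_right]
    simp only [hW.covariance_fun_eval]
    rw [min_eq_left hmono, min_eq_left (hle s), min_eq_right (hle t), min_self]
    push_cast
    have hs : (s : ℝ) + T ≠ 0 := by positivity
    have ht : (t : ℝ) + T ≠ 0 := by positivity
    field_simp
    ring

/-- Crossing probability of a bridge over a line which is positive at both endpoints. -/
lemma ProbabilityTheory.IsPreBrownianReal.measure_bridge_cross_le (hW : IsPreBrownianReal W P)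
    (hWm : ∀ t, Measurable (W t)) {T : ℝ≥0} (hT : 0 < T) {q : ℕ → ℝ≥0} (hq : ∀ n, q n ≤ T)
    (c : ℝ) {y : ℝ} (hy : 0 < y) :
    P {ω | ∃ n, c * (1 - q n / T) + y * (q n / T) ≤ bridge W T (q n) ω}
      ≤ ENNReal.ofReal (Real.exp (-(2 * c * y / T))) := by
  have hT' : (0 : ℝ) < T := hT
  have h := (hW.scaled_bridge hT).measure_cross_line_le
    (fun t ↦ (measurable_bridge hWm _ _).const_mul _) c (a := y / T) (by positivity)
    (fun n ↦ q n * T / (T - q n))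
  rw [show 2 * (y / T) * c = 2 * c * y / T by ring] at h
  refine le_trans (measure_mono ?_) h
  rintro ω ⟨n, hn⟩
  refine ⟨n, ?_⟩
  rcases (hq n).eq_or_lt with hqT | hqT
  · rw [hqT, bridge_self W hT, div_self hT'.ne'] at hn
    linarith
  · have hqT' : (q n : ℝ) < T := hqT
    have hpos : (0 : ℝ) < T - q n := by linarith
    set s : ℝ≥0 := q n * T / (T - q n) with hs
    have hsc : (s : ℝ) = q n * T / (T - q n) := by
      rw [hs]; push_cast [NNReal.coe_sub hqT.le]; rfl
    have hback : s * T / (s + T) = q n := by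
      ext
      push_cast
      rw [hsc]
      field_simp
      ring
    rw [hback]
    have hfac : ((s : ℝ) + T) / T = T / (T - q n) := by
      rw [hsc]; field_simp; ring
    rw [hfac]
    calc c + y / T * s = T / (T - q n) * (c * (1 - q n / T) + y * (q n / T)) := by
          rw [hsc]; field_simp
      _ ≤ _ := by gcongr

/-- Gaussian tail of the maximum of the bridge. -/
lemma ProbabilityTheory.IsPreBrownianReal.measure_exists_abs_bridge_ge_le
    (hW : IsPreBrownianReal W P) (hWm : ∀ t, Measurable (W t)) {T : ℝ≥0} (hT : 0 < T) {x : ℝ}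
    (hx : 0 ≤ x) {q : ℕ → ℝ≥0} (hq : ∀ n, q n ≤ T) :
    P {ω | ∃ n, x ≤ |bridge W T (q n) ω|} ≤
      4 * ENNReal.ofReal (Real.exp (-(x ^ 2 / (8 * T)))) := by
  have hT' : (0 : ℝ) < T := hT
  have h1 := hW.measure_exists_abs_ge_le hWm hT (x := x / 2) (by positivity) hq
  have h2 := hW.measure_exists_abs_ge_le hWm hT (x := x / 2) (by positivity) (q := fun _ ↦ T)
    fun _ ↦ le_rfl
  have e : (x / 2) ^ 2 / (2 * T) = x ^ 2 / (8 * T) := by ring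
  rw [e] at h1 h2
  have h4 : (4 : ℝ≥0∞) * ENNReal.ofReal (Real.exp (-(x ^ 2 / (8 * T)))) =
      2 * ENNReal.ofReal (Real.exp (-(x ^ 2 / (8 * T)))) +
      2 * ENNReal.ofReal (Real.exp (-(x ^ 2 / (8 * T)))) := by
    rw [← add_mul]; norm_num
  rw [h4]
  refine le_trans ?_ (add_le_add h1 h2)
  refine (measure_mono ?_).trans (measure_union_le _ _)
  rintro ω ⟨n, hn⟩
  have hfrac : (q n : ℝ) / T ≤ 1 := by
    rw [div_le_one hT']; exact hq n
  have hb : |bridge W T (q n) ω| ≤ |W (q n) ω| + |W T ω| := by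
    refine (abs_sub _ _).trans ?_
    rw [abs_mul, abs_of_nonneg (by positivity : (0 : ℝ) ≤ q n / T)]
    gcongr
    exact mul_le_of_le_one_left (abs_nonneg _) hfrac
  by_cases h : x / 2 ≤ |W (q n) ω|
  · left
    exact ⟨n, h⟩
  · right
    exact ⟨0, by push Not at h; linarith⟩

/-- The exponential of the normalized maximum of a path sampled at countably many times. -/
noncomputable def expSup (l : ℝ) (T : ℝ≥0) (w : ℕ → ℝ) : ℝ≥0∞ :=
  ⨆ n, ENNReal.ofReal (Real.exp (l * (|w n| / √T)))

lemma measurable_expSup (l : ℝ) (T : ℝ≥0) : Measurable (expSup l T) := by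
  unfold expSup
  refine Measurable.iSup fun n ↦ ?_
  have : Measurable fun w : ℕ → ℝ ↦ w n := measurable_pi_apply n
  exact (((this.abs.div_const _).const_mul _).exp).ennreal_ofReal

lemma expSup_pow (l : ℝ) (T : ℝ≥0) (w : ℕ → ℝ) (k : ℕ) :
    expSup l T w ^ k = expSup (k * l) T w := by
  unfold expSup
  rw [ENNReal.iSup_pow]
  congr! 2 with n
  rw [← ENNReal.ofReal_pow (Real.exp_pos _).le, ← Real.exp_nat_mul, mul_assoc]

/-- The constant of the exponential moment bound. -/
noncomputable def expMomentConst (l : ℝ) : ℝ≥0∞ :=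
  ∑' n : ℕ, 4 * ENNReal.ofReal (Real.exp (l * (n + 1) - n ^ 2 / 8))

lemma expMomentConst_ne_top (l : ℝ) : expMomentConst l ≠ ∞ := by
  unfold expMomentConst
  rw [ENNReal.tsum_mul_left]
  refine ENNReal.mul_ne_top (by simp) ?_
  refine Summable.tsum_ofReal_ne_top ?_
  -- compare with a geometric series
  have hgeo : Summable fun n : ℕ ↦ Real.exp (l + 2 * (l + 1) ^ 2) * Real.exp (-(n : ℝ)) :=
    Real.summable_exp_neg_nat.mul_left _
  refine hgeo.of_nonneg_of_le (fun n ↦ (Real.exp_pos _).le) fun n ↦ ?_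
  rw [← Real.exp_add]
  refine Real.exp_le_exp.2 ?_
  nlinarith [sq_nonneg ((n : ℝ) - 4 * (l + 1))]

lemma ProbabilityTheory.IsPreBrownianReal.lintegral_expSup_bridge_le
    (hW : IsPreBrownianReal W P) (hWm : ∀ t, Measurable (W t)) {T : ℝ≥0} (hT : 0 < T) {l : ℝ}
    (hl : 0 ≤ l) {q : ℕ → ℝ≥0} (hq : ∀ n, q n ≤ T) :
    ∫⁻ ω, expSup l T (fun n ↦ bridge W T (q n) ω) ∂P ≤ expMomentConst l := by
  have hT' : (0 : ℝ) < T := hT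
  have hs : 0 < √(T : ℝ) := Real.sqrt_pos.2 hT'
  let S : ℕ → Set Ω := fun n ↦ {ω | ∃ k, n * √T ≤ |bridge W T (q k) ω|}
  have hS n : MeasurableSet (S n) := by
    have : S n = ⋃ k, {ω | n * √T ≤ |bridge W T (q k) ω|} := by ext; simp [S]
    rw [this]
    exact MeasurableSet.iUnion fun k ↦
      measurableSet_le measurable_const (measurable_bridge hWm _ _).abs
  calc ∫⁻ ω, expSup l T (fun n ↦ bridge W T (q n) ω) ∂P
      ≤ ∫⁻ ω, ∑' n : ℕ, (S n).indicator
        (fun _ ↦ ENNReal.ofReal (Real.exp (l * (n + 1)))) ω ∂P := by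
        refine lintegral_mono fun ω ↦ iSup_le fun k ↦ ?_
        set x := |bridge W T (q k) ω| / √T with hx
        have hx0 : 0 ≤ x := by positivity
        have hmem : ω ∈ S ⌊x⌋₊ := by
          refine ⟨k, ?_⟩
          rw [← le_div_iff₀ hs]
          exact Nat.floor_le hx0
        refine le_trans ?_ (ENNReal.le_tsum ⌊x⌋₊)
        rw [Set.indicator_of_mem hmem]
        refine ENNReal.ofReal_le_ofReal (Real.exp_le_exp.2 ?_)
        gcongr
        exact (Nat.lt_floor_add_one x).le
    _ = ∑' n : ℕ, ENNReal.ofReal (Real.exp (l * (n + 1))) * P (S n) := by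
        rw [lintegral_tsum fun n ↦ (measurable_const.indicator (hS n)).aemeasurable]
        refine tsum_congr fun n ↦ ?_
        rw [lintegral_indicator_const (hS n)]
    _ ≤ expMomentConst l := by
        refine ENNReal.tsum_le_tsum fun n ↦ ?_
        refine (mul_le_mul_right (hW.measure_exists_abs_bridge_ge_le hWm hT (by positivity) hq)
          _).trans_eq ?_
        have e : ((n : ℝ) * √T) ^ 2 / (8 * T) = n ^ 2 / 8 := by
          rw [mul_pow, Real.sq_sqrt hT'.le]; field_simp
        rw [e, mul_left_comm, ← ENNReal.ofReal_mul (Real.exp_pos _).le, ← Real.exp_add]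
        rfl

end Bridge

/-! ### Estimates conditional on the terminal value -/

section Conditional

variable {Ω : Type*} {mΩ : MeasurableSpace Ω} {P : Measure Ω} {W : ℝ≥0 → Ω → ℝ}

/-- The paths `w` of a bridge, sampled at the times `q n`, for which `σ w` with the linear path
from `0` to `b + y` added comes arbitrarily close to the level `b`. -/
def reachSet (σ b : ℝ) (T : ℝ≥0) (q : ℕ → ℝ≥0) (y : ℝ) : Set (ℕ → ℝ) :=
  {w | ∀ j : ℕ, ∃ n, b - 1 / (j + 1) ≤ σ * w n + q n / T * (b + y)}

lemma measurableSet_reachSet (σ b : ℝ) (T : ℝ≥0) (q : ℕ → ℝ≥0) :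
    MeasurableSet {p : (ℕ → ℝ) × ℝ | p.1 ∈ reachSet σ b T q p.2} := by
  have : {p : (ℕ → ℝ) × ℝ | p.1 ∈ reachSet σ b T q p.2} =
      ⋂ j : ℕ, ⋃ n, {p | b - 1 / (j + 1) ≤ σ * p.1 n + q n / T * (b + p.2)} := by
    ext; simp [reachSet]
  rw [this]
  refine MeasurableSet.iInter fun j ↦ MeasurableSet.iUnion fun n ↦
    measurableSet_le measurable_const ?_
  have : Measurable fun p : (ℕ → ℝ) × ℝ ↦ p.1 n := (measurable_pi_apply n).comp measurable_fst
  fun_prop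

lemma ProbabilityTheory.IsPreBrownianReal.measure_bridge_mem_reachSet_le
    (hW : IsPreBrownianReal W P) (hWm : ∀ t, Measurable (W t)) {T : ℝ≥0} (hT : 0 < T)
    {q : ℕ → ℝ≥0} (hq : ∀ n, q n ≤ T) {σ : ℝ} (hσ : 0 < σ) (b : ℝ) {y : ℝ} (hy : y < 0) :
    P {ω | (fun n ↦ bridge W T (q n) ω) ∈ reachSet σ b T q y} ≤
      ENNReal.ofReal (Real.exp (2 * b * y / (σ ^ 2 * T))) := by
  have hT' : (0 : ℝ) < T := hT
  have hε := tendsto_one_div_add_atTop_nhds_zero_nat (𝕜 := ℝ)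
  have hlim : Tendsto (fun j : ℕ ↦ ENNReal.ofReal (Real.exp
      (-(2 * ((b - 1 / ((j : ℝ) + 1)) / σ) * ((-y - 1 / ((j : ℝ) + 1)) / σ) / T)))) atTop
      (𝓝 (ENNReal.ofReal (Real.exp (2 * b * y / (σ ^ 2 * T))))) := by
    have hc : Continuous fun ε : ℝ ↦ ENNReal.ofReal (Real.exp
      (-(2 * ((b - ε) / σ) * ((-y - ε) / σ) / T))) :=
      ENNReal.continuous_ofReal.comp (by fun_prop)
    have h1 := (hc.tendsto 0).comp hε
    have e : -(2 * ((b - 0) / σ) * ((-y - 0) / σ) / T) = 2 * b * y / (σ ^ 2 * T) := by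
      field_simp
      ring
    rw [e] at h1
    exact h1
  refine ge_of_tendsto hlim ?_
  filter_upwards [hε.eventually_lt_const (show 0 < -y by linarith)] with j hj
  refine le_trans (measure_mono ?_) (hW.measure_bridge_cross_le hWm hT hq
    ((b - 1 / ((j : ℝ) + 1)) / σ) (y := (-y - 1 / ((j : ℝ) + 1)) / σ)
    (div_pos (by linarith) hσ))
  intro ω hω
  obtain ⟨n, hn⟩ := hω j
  refine ⟨n, ?_⟩
  simp only at hn
  have h1 : (b - 1 / ((j : ℝ) + 1)) / σ * (1 - q n / T) +
      (-y - 1 / ((j : ℝ) + 1)) / σ * (q n / T) =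
      (b - 1 / ((j : ℝ) + 1) - q n / T * (b + y)) / σ := by
    field_simp
    ring
  rw [h1, div_le_iff₀ hσ]
  linarith

/-- Conditionally on the terminal value, the exponential of the maximum of the bridge on the event
of reaching the level `b`. -/
lemma ProbabilityTheory.IsPreBrownianReal.lintegral_expSup_reachSet_le
    (hW : IsPreBrownianReal W P) (hWm : ∀ t, Measurable (W t)) {T : ℝ≥0} (hT : 0 < T)
    {q : ℕ → ℝ≥0} (hq : ∀ n, q n ≤ T) {σ : ℝ} (hσ : 0 < σ) (b y : ℝ) {l : ℝ} (hl : 0 ≤ l) :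
    ∫⁻ ω, (expSup l T fun n ↦ bridge W T (q n) ω) *
        (reachSet σ b T q y).indicator 1 (fun n ↦ bridge W T (q n) ω) ∂P ≤
      expMomentConst (4 * l) ^ (1 / 4 : ℝ) *
        ENNReal.ofReal (Real.exp (3 / 2 * b * min y 0 / (σ ^ 2 * T))) := by
  have := hW.isGaussianProcess.isProbabilityMeasure
  have hβ : Measurable fun ω n ↦ bridge W T (q n) ω :=
    measurable_pi_lambda _ fun n ↦ measurable_bridge hWm T (q n)
  have hset : MeasurableSet (reachSet σ b T q y) :=
    (measurableSet_reachSet σ b T q).preimage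
      (measurable_id.prodMk (measurable_const (a := y)))
  have hset' : MeasurableSet {ω | (fun n ↦ bridge W T (q n) ω) ∈ reachSet σ b T q y} :=
    hset.preimage hβ
  have hprob : P {ω | (fun n ↦ bridge W T (q n) ω) ∈ reachSet σ b T q y} ^ (3 / 4 : ℝ) ≤
      ENNReal.ofReal (Real.exp (3 / 2 * b * min y 0 / (σ ^ 2 * T))) := by
    rcases lt_or_ge y 0 with hy | hy
    · have h1 := hW.measure_bridge_mem_reachSet_le hWm hT hq hσ b hy
      refine (ENNReal.rpow_le_rpow h1 (by norm_num)).trans_eq ?_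
      rw [ENNReal.ofReal_rpow_of_pos (Real.exp_pos _), ← Real.exp_mul, min_eq_left hy.le]
      congr 2
      ring
    · rw [min_eq_right hy]
      simp only [mul_zero, zero_div, Real.exp_zero, ENNReal.ofReal_one]
      exact ENNReal.rpow_le_one prob_le_one (by norm_num)
  have hholder := ENNReal.lintegral_mul_le_Lp_mul_Lq P
    (show Real.HolderConjugate 4 (4 / 3) by constructor <;> norm_num)
    (f := fun ω ↦ expSup l T fun n ↦ bridge W T (q n) ω)
    (g := fun ω ↦ (reachSet σ b T q y).indicator 1 (fun n ↦ bridge W T (q n) ω))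
    ((measurable_expSup l T).comp hβ).aemeasurable
    ((measurable_one.indicator hset).comp hβ).aemeasurable
  refine hholder.trans (mul_le_mul' ?_ ?_)
  · refine ENNReal.rpow_le_rpow ?_ (by norm_num)
    refine le_trans (le_of_eq ?_) (hW.lintegral_expSup_bridge_le hWm hT (l := 4 * l)
      (by positivity) hq)
    refine lintegral_congr fun ω ↦ ?_
    have := expSup_pow l T (fun n ↦ bridge W T (q n) ω) 4
    rw [← ENNReal.rpow_natCast] at this
    simpa using this
  · have e : ∫⁻ ω, (reachSet σ b T q y).indicator (1 : (ℕ → ℝ) → ℝ≥0∞)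
        (fun n ↦ bridge W T (q n) ω) ^ (4 / 3 : ℝ) ∂P =
        P {ω | (fun n ↦ bridge W T (q n) ω) ∈ reachSet σ b T q y} := by
      rw [← lintegral_indicator_one hset']
      refine lintegral_congr fun ω ↦ ?_
      by_cases h : (fun n ↦ bridge W T (q n) ω) ∈ reachSet σ b T q y
      · rw [Set.indicator_of_mem h, Set.indicator_of_mem (by exact h)]
        simp
      · rw [Set.indicator_of_notMem h, Set.indicator_of_notMem (by exact h)]
        norm_num
    rw [e]
    refine le_trans (le_of_eq ?_) hprob
    norm_num

/-! ### Integration over the terminal value -/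

lemma lintegral_exp_neg_mul_abs {a : ℝ} (ha : 0 < a) :
    ∫⁻ y : ℝ, ENNReal.ofReal (Real.exp (-a * |y|)) = ENNReal.ofReal (2 / a) := by
  have h1 : ∫ y : ℝ, Real.exp (-a * |y|) = 2 / a := by
    rw [integral_comp_abs (f := fun y ↦ Real.exp (-a * y)), integral_exp_mul_Ioi (by linarith)]
    simp
    ring
  have hInt : Integrable fun y : ℝ ↦ Real.exp (-a * |y|) := by
    by_contra h
    rw [integral_undef h] at h1
    have : 0 < 2 / a := by positivity
    linarith
  rw [← ofReal_integral_eq_lintegral_ofReal hInt (Eventually.of_forall fun _ ↦ (Real.exp_pos _).le),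
    h1]

lemma gaussianPDFReal_neg_mean (m : ℝ) (v : ℝ≥0) (y : ℝ) :
    gaussianPDFReal (-m) v y =
      gaussianPDFReal (-m) v 0 * Real.exp (-(2 * m * y + y ^ 2) / (2 * v)) := by
  simp only [gaussianPDFReal]
  rw [mul_assoc _ (Real.exp _), ← Real.exp_add]
  ring_nf

lemma gaussianPDFReal_neg_mean_le (m : ℝ) (v : ℝ≥0) (y : ℝ) :
    gaussianPDFReal (-m) v y ≤ gaussianPDFReal (-m) v 0 * Real.exp (-(m * y) / v) := by
  rw [gaussianPDFReal_neg_mean]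
  refine mul_le_mul_of_nonneg_left (Real.exp_le_exp.2 ?_) (gaussianPDFReal_nonneg _ _ _)
  have : -(m * y) / v = -(2 * m * y) / (2 * v : ℝ) := by
    rw [show -(2 * m * y) = 2 * (-(m * y)) by ring, mul_div_mul_left _ _ two_ne_zero]
  rw [this]
  gcongr
  nlinarith [sq_nonneg y]

lemma exponent_le {b m v y : ℝ} (hv : 0 < v) (hvb : 8 * v ≤ b) (hm1 : 7 / 8 * b ≤ m)
    (hm2 : m ≤ 9 / 8 * b) :
    |y| + -(m * y) / v + 3 / 2 * b * min y 0 / v ≤ -(b / (4 * v)) * |y| := by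
  have key : |y| * v + -(m * y) + 3 / 2 * b * min y 0 ≤ -(b / 4) * |y| := by
    rcases le_or_gt 0 y with hy | hy
    · rw [abs_of_nonneg hy, min_eq_right hy]
      nlinarith
    · rw [abs_of_neg hy, min_eq_left hy.le]
      nlinarith
  have h2 : |y| + -(m * y) / v + 3 / 2 * b * min y 0 / v =
      (|y| * v + -(m * y) + 3 / 2 * b * min y 0) / v := by field_simp
  have h3 : -(b / (4 * v)) * |y| = (-(b / 4) * |y|) / v := by field_simp
  rw [h2, h3]
  gcongr

lemma add_abs_le_mul_exp {k T : ℝ} (hk : 0 < k) (hT : 0 < T) (hT1 : T ≤ 1) (y : ℝ) :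
    √T + |y| ≤ √T * ((1 + 2 / k) * Real.exp (k / (2 * T) * |y|)) := by
  have hs : 0 < √T := Real.sqrt_pos.2 hT
  have hTs : T ≤ √T := by
    nlinarith [Real.mul_self_sqrt hT.le, Real.sqrt_le_one.2 hT1]
  have h1 : |y| ≤ √T * (|y| / T) := by
    rw [mul_div_assoc', le_div_iff₀ hT, mul_comm]
    gcongr
  have h2 : 1 + |y| / T ≤ (1 + 2 / k) * Real.exp (k / (2 * T) * |y|) := by
    have h3 := Real.add_one_le_exp (k / (2 * T) * |y|)
    calc 1 + |y| / T ≤ (1 + 2 / k) * (k / (2 * T) * |y| + 1) := by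
          have h4 : (1 + 2 / k) * (k / (2 * T) * |y| + 1) =
              1 + |y| / T + 2 / k + k / (2 * T) * |y| := by field_simp; ring
          rw [h4]
          have : 0 ≤ 2 / k := by positivity
          have : 0 ≤ k / (2 * T) * |y| := by positivity
          linarith
      _ ≤ _ := by gcongr
  calc √T + |y| ≤ √T + √T * (|y| / T) := by gcongr
    _ = √T * (1 + |y| / T) := by ring
    _ ≤ _ := by gcongr

/-- The bound of the deviation integrated over the terminal value. -/
lemma lintegral_terminal_le {σ b B m : ℝ} {T v : ℝ≥0} (hσ : 0 < σ) (hb : 0 < b) (hB : 0 ≤ B)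
    (hT : 0 < T) (hT1 : T ≤ 1) (hv : (v : ℝ) = σ ^ 2 * T) (hvb : 8 * (σ ^ 2 * T) ≤ b)
    (hm1 : 7 / 8 * b ≤ m) (hm2 : m ≤ 9 / 8 * b) :
    ∫⁻ y, ENNReal.ofReal (B * (√T + |y|) * Real.exp |y|) *
        ENNReal.ofReal (Real.exp (3 / 2 * b * min y 0 / (σ ^ 2 * T))) ∂(gaussianReal (-m) v) ≤
      ENNReal.ofReal (B * (1 + 8 * σ ^ 2 / b) * (16 * σ ^ 2 / b)) *
        ENNReal.ofReal (gaussianPDFReal (-m) v 0 * T * √T) := by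
  have hT' : (0 : ℝ) < T := hT
  have hT1' : (T : ℝ) ≤ 1 := by exact_mod_cast hT1
  have hvpos : (0 : ℝ) < σ ^ 2 * T := by positivity
  have hv0 : v ≠ 0 := by
    rintro rfl
    rw [← hv] at hvpos
    simp at hvpos
  set k : ℝ := b / (4 * σ ^ 2) with hk
  have hk0 : 0 < k := by positivity
  set p0 := gaussianPDFReal (-m) v 0 with hp0
  have hp00 : 0 ≤ p0 := gaussianPDFReal_nonneg _ _ _
  rw [gaussianReal_of_var_ne_zero _ hv0, lintegral_withDensity_eq_lintegral_mul _
    (measurable_gaussianPDF _ _) (by fun_prop)]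
  have hpt (y : ℝ) : gaussianPDFReal (-m) v y * (B * (√T + |y|) * Real.exp |y| *
      Real.exp (3 / 2 * b * min y 0 / (σ ^ 2 * T))) ≤
      (B * (1 + 2 / k) * p0 * √T) * Real.exp (-(k / (2 * T)) * |y|) := by
    calc _ ≤ (p0 * Real.exp (-(m * y) / v)) * (B * (√T + |y|) * Real.exp |y| *
          Real.exp (3 / 2 * b * min y 0 / (σ ^ 2 * T))) := by
          gcongr
          exact gaussianPDFReal_neg_mean_le m v y
      _ = p0 * B * (√T + |y|) * Real.exp (|y| + -(m * y) / (σ ^ 2 * T) +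
          3 / 2 * b * min y 0 / (σ ^ 2 * T)) := by
          rw [Real.exp_add, Real.exp_add, hv]; ring
      _ ≤ p0 * B * (√T * ((1 + 2 / k) * Real.exp (k / (2 * T) * |y|))) *
          Real.exp (-(b / (4 * (σ ^ 2 * T))) * |y|) := by
          gcongr
          · exact add_abs_le_mul_exp hk0 hT' hT1' y
          · exact exponent_le hvpos hvb hm1 hm2
      _ = (B * (1 + 2 / k) * p0 * √T) * (Real.exp (k / (2 * T) * |y|) *
          Real.exp (-(b / (4 * (σ ^ 2 * T))) * |y|)) := by ring
      _ = _ := by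
          rw [← Real.exp_add]
          congr 2
          rw [hk]
          field_simp
          ring
  calc _ ≤ ∫⁻ y : ℝ, ENNReal.ofReal (B * (1 + 2 / k) * p0 * √T) *
        ENNReal.ofReal (Real.exp (-(k / (2 * T)) * |y|)) := by
        refine lintegral_mono fun y ↦ ?_
        simp only [Pi.mul_apply, gaussianPDF]
        rw [← ENNReal.ofReal_mul (by positivity),
          ← ENNReal.ofReal_mul (gaussianPDFReal_nonneg _ _ _), ← ENNReal.ofReal_mul (by positivity)]
        exact ENNReal.ofReal_le_ofReal (hpt y)
    _ = ENNReal.ofReal (B * (1 + 2 / k) * p0 * √T) * ENNReal.ofReal (2 / (k / (2 * T))) := by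
        rw [lintegral_const_mul _ (by fun_prop), lintegral_exp_neg_mul_abs (by positivity)]
    _ = _ := by
        rw [← ENNReal.ofReal_mul (by positivity), ← ENNReal.ofReal_mul (by positivity)]
        congr 1
        rw [hk]
        field_simp
        ring

/-- Lower bound for the probability that the terminal value exceeds the level. -/
lemma ofReal_mul_le_gaussianReal_Ici {σ b m : ℝ} {T v : ℝ≥0} (hσ : 0 < σ) (hb : 0 < b)
    (hT : 0 < T) (hT1 : T ≤ 1) (hv : (v : ℝ) = σ ^ 2 * T) (hm2 : m ≤ 9 / 8 * b) :
    ENNReal.ofReal (Real.exp (-((9 / 4 * b + 1) / (2 * σ ^ 2)))) *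
        ENNReal.ofReal (gaussianPDFReal (-m) v 0 * T) ≤
      gaussianReal (-m) v (Set.Ici 0) := by
  have hT' : (0 : ℝ) < T := hT
  have hT1' : (T : ℝ) ≤ 1 := by exact_mod_cast hT1
  have hvpos : (0 : ℝ) < σ ^ 2 * T := by positivity
  have hv0 : v ≠ 0 := by
    rintro rfl
    rw [← hv] at hvpos
    simp at hvpos
  set p0 := gaussianPDFReal (-m) v 0 with hp0
  have hp00 : 0 ≤ p0 := gaussianPDFReal_nonneg _ _ _
  set c := Real.exp (-((9 / 4 * b + 1) / (2 * σ ^ 2))) with hc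
  rw [gaussianReal_apply _ hv0]
  calc ENNReal.ofReal c * ENNReal.ofReal (p0 * T)
      = ∫⁻ y in Set.Icc (0 : ℝ) T, ENNReal.ofReal (c * p0) := by
        rw [setLIntegral_const, Real.volume_Icc, sub_zero, ← ENNReal.ofReal_mul (by positivity),
          ← ENNReal.ofReal_mul (by positivity), mul_assoc]
    _ ≤ ∫⁻ y in Set.Icc (0 : ℝ) T, gaussianPDF (-m) v y := by
        refine setLIntegral_mono' measurableSet_Icc fun y hy ↦ ENNReal.ofReal_le_ofReal ?_
        rw [gaussianPDFReal_neg_mean, ← hp0, mul_comm, hc, hv]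
        refine mul_le_mul_of_nonneg_left (Real.exp_le_exp.2 ?_) hp00
        rw [neg_div, neg_le_neg_iff, div_le_div_iff₀ (by positivity) (by positivity)]
        have h1 : 2 * m * y + y ^ 2 ≤ (9 / 4 * b + 1) * T := by
          nlinarith [hy.1, hy.2, mul_le_mul_of_nonneg_right hm2 hy.1,
            mul_le_mul_of_nonneg_left hy.2 hb.le]
        calc (2 * m * y + y ^ 2) * (2 * σ ^ 2) ≤ ((9 / 4 * b + 1) * T) * (2 * σ ^ 2) := by gcongr
          _ = _ := by ring
    _ ≤ _ := lintegral_mono_set fun y hy ↦ hy.1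

end Conditional

/-! ### Pathwise estimates -/

section Path

variable {Ω : Type*} {mΩ : MeasurableSpace Ω} {P : Measure Ω} {W X : ℝ≥0 → Ω → ℝ}

/-- A dense sequence of times in `[0, T]`. -/
noncomputable def denseTime (T : ℝ≥0) (n : ℕ) : ℝ≥0 := min (TopologicalSpace.denseSeq ℝ≥0 n) T

lemma denseTime_le (T : ℝ≥0) (n : ℕ) : denseTime T n ≤ T := min_le_right _ _

lemma exists_denseTime_mem {T t : ℝ≥0} (ht : t ≤ T) {U : Set ℝ≥0} (hU : IsOpen U) (htU : t ∈ U) :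
    ∃ n, denseTime T n ∈ U := by
  have hV : IsOpen ((fun u ↦ min u T) ⁻¹' U) := hU.preimage (by fun_prop)
  exact (TopologicalSpace.denseRange_denseSeq ℝ≥0).exists_mem_open hV
    ⟨t, by simpa [min_eq_left ht] using htU⟩

lemma le_of_forall_denseTime_le {α : Type*} [TopologicalSpace α] [LinearOrder α]
    [OrderClosedTopology α] {f : ℝ≥0 → α} (hf : Continuous f) {T : ℝ≥0} {a : α}
    (h : ∀ n, f (denseTime T n) ≤ a) {t : ℝ≥0} (ht : t ≤ T) : f t ≤ a := by
  by_contra! hlt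
  obtain ⟨n, hn⟩ := exists_denseTime_mem ht (isOpen_Ioi.preimage hf) hlt
  exact absurd (h n) (not_le.2 hn)

lemma bddAbove_range_Icc {f : ℝ≥0 → ℝ} (hf : Continuous f) (T : ℝ≥0) :
    BddAbove (Set.range fun t : Set.Icc (0 : ℝ≥0) T ↦ f t) := by
  obtain ⟨C, hC⟩ := (isCompact_Icc (a := (0 : ℝ≥0)) (b := T)).bddAbove_image hf.continuousOn
  exact ⟨C, by rintro _ ⟨t, rfl⟩; exact hC ⟨t, t.2, rfl⟩⟩

lemma iSup_Icc_eq_iSup_denseTime {f : ℝ≥0 → ℝ} (hf : Continuous f) (T : ℝ≥0) :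
    ⨆ t : Set.Icc (0 : ℝ≥0) T, f t = ⨆ n, f (denseTime T n) := by
  have hb := bddAbove_range_Icc hf T
  have : Nonempty (Set.Icc (0 : ℝ≥0) T) := ⟨0, le_rfl, zero_le⟩
  have hle n : f (denseTime T n) ≤ ⨆ t : Set.Icc (0 : ℝ≥0) T, f t :=
    le_ciSup hb (⟨denseTime T n, zero_le, denseTime_le T n⟩ : Set.Icc (0 : ℝ≥0) T)
  refine le_antisymm (ciSup_le fun t ↦ ?_) (ciSup_le hle)
  refine le_of_forall_denseTime_le hf (fun n ↦ ?_) t.2.2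
  exact le_ciSup (f := fun n ↦ f (denseTime T n)) ⟨_, by rintro _ ⟨n, rfl⟩; exact hle n⟩ n

lemma aemeasurable_iSup_Icc {Z : ℝ≥0 → Ω → ℝ} (hZ : ∀ t, Measurable (Z t))
    (hc : ∀ᵐ ω ∂P, Continuous (Z · ω)) (T : ℝ≥0) :
    AEMeasurable (fun ω ↦ ⨆ t : Set.Icc (0 : ℝ≥0) T, Z t ω) P := by
  refine ⟨fun ω ↦ ⨆ n, Z (denseTime T n) ω, Measurable.iSup fun n ↦ hZ _, ?_⟩
  filter_upwards [hc] with ω hω using iSup_Icc_eq_iSup_denseTime hω T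

/-- The logarithmic excess of the terminal value over the level `B`. -/
noncomputable def terminalExcess (μ σ B : ℝ) (W : ℝ≥0 → Ω → ℝ) (T : ℝ≥0) (ω : Ω) : ℝ :=
  σ * W T ω + ((μ - σ ^ 2 / 2) * T - Real.log B)

lemma gbm_eq_exp_bridge (μ σ B : ℝ) (W : ℝ≥0 → Ω → ℝ) {T : ℝ≥0} (hT : 0 < T) (t : ℝ≥0) (ω : Ω) :
    gbm μ σ W t ω = Real.exp (σ * bridge W T t ω +
      t / T * (Real.log B + terminalExcess μ σ B W T ω)) := by
  have hT' : (0 : ℝ) < T := hT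
  rw [gbm, bridge, terminalExcess]
  congr 1
  field_simp
  ring

variable {μ σ B : ℝ} {T : ℝ≥0} {ω : Ω}

lemma mem_reachSet_of_mem_hitEvent (hB : 0 < B) (hT : 0 < T) (hW : Continuous (W · ω))
    (hX : ∀ t, X t ω = gbm μ σ W t ω) (h : ω ∈ hitEvent X B T) :
    (fun n ↦ bridge W T (denseTime T n) ω) ∈
      reachSet σ (Real.log B) T (denseTime T) (terminalExcess μ σ B W T ω) := by
  intro j
  have hXc : Continuous (X · ω) := by
    simp_rw [hX, gbm]
    fun_prop
  obtain ⟨t, ht, hmax⟩ := (isCompact_Icc (a := (0 : ℝ≥0)) (b := T)).exists_isMaxOn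
    ⟨0, le_rfl, zero_le⟩ hXc.continuousOn
  have : Nonempty (Set.Icc (0 : ℝ≥0) T) := ⟨0, le_rfl, zero_le⟩
  have hBt : B ≤ X t ω := le_trans (show B ≤ runningMax X T ω from h)
    (ciSup_le fun s ↦ hmax s.2)
  let V : ℝ≥0 → ℝ := fun t ↦ σ * bridge W T t ω +
      t / T * (Real.log B + terminalExcess μ σ B W T ω)
  have hVc : Continuous V := by
    simp only [V, bridge]
    fun_prop
  have hVt : Real.log B ≤ V t := by
    rw [hX, gbm_eq_exp_bridge μ σ B W hT] at hBt
    exact (Real.log_le_iff_le_exp hB).2 hBt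
  obtain ⟨n, hn⟩ := exists_denseTime_mem ht.2
    (isOpen_Ioi.preimage hVc : IsOpen (V ⁻¹' Set.Ioi (Real.log B - 1 / ((j : ℝ) + 1))))
    (by
      have : (0 : ℝ) < 1 / ((j : ℝ) + 1) := by positivity
      change Real.log B - 1 / ((j : ℝ) + 1) < V t
      linarith)
  exact ⟨n, (Set.mem_Ioi.1 hn).le⟩

lemma mem_hitEvent_of_terminalExcess_nonneg (hB : 0 < B) (hT : 0 < T) (hW : Continuous (W · ω))
    (hX : ∀ t, X t ω = gbm μ σ W t ω) (h : 0 ≤ terminalExcess μ σ B W T ω) :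
    ω ∈ hitEvent X B T := by
  have hXc : Continuous (X · ω) := by
    simp_rw [hX, gbm]
    fun_prop
  have hle := le_ciSup (bddAbove_range_Icc hXc T) (⟨T, zero_le, le_rfl⟩ : Set.Icc (0 : ℝ≥0) T)
  refine le_trans ?_ hle
  rw [hX, gbm_eq_exp_bridge μ σ B W hT, bridge_self W hT, div_self (by positivity)]
  rw [← Real.log_le_iff_le_exp hB]
  linarith

lemma abs_exp_sub_exp_le (x y : ℝ) :
    |Real.exp x - Real.exp y| ≤ Real.exp y * (|x - y| * Real.exp |x - y|) := by
  have h1 : Real.exp x - Real.exp y = Real.exp y * (Real.exp (x - y) - 1) := by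
    rw [mul_sub, ← Real.exp_add]; ring_nf
  rw [h1, abs_mul, abs_of_pos (Real.exp_pos y)]
  gcongr
  set d := x - y
  have h2 := Real.add_one_le_exp d
  have h3 := Real.add_one_le_exp (-d)
  have h4 : Real.exp d * Real.exp (-d) = 1 := by rw [← Real.exp_add]; simp
  rcases le_or_gt 0 d with hd | hd
  · rw [abs_of_nonneg hd, abs_of_nonneg (by linarith)]
    nlinarith [Real.exp_pos d]
  · have h5 : 1 ≤ Real.exp |d| := Real.one_le_exp (abs_nonneg d)
    have h6 : Real.exp d ≤ 1 := Real.exp_le_one_iff.2 hd.le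
    rw [abs_of_nonpos (by linarith)]
    have h7 : |d| = -d := abs_of_neg hd
    nlinarith [abs_nonneg d]

/-- The deviation from the exponential curve in terms of the bridge and the terminal value. -/
lemma ofReal_supDeviation_le (hσ : 0 < σ) (hB : 1 < B) (hT : 0 < T) (hT1 : T ≤ 1)
    (hW : Continuous (W · ω)) (hX : ∀ t, X t ω = gbm μ σ W t ω) :
    ENNReal.ofReal (supDeviation X B T ω) ≤
      ENNReal.ofReal (B * (√T + |terminalExcess μ σ B W T ω|) *
        Real.exp |terminalExcess μ σ B W T ω|) *
        expSup (2 * σ) T (fun n ↦ bridge W T (denseTime T n) ω) := by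
  have hT' : (0 : ℝ) < T := hT
  have hT1' : (T : ℝ) ≤ 1 := by exact_mod_cast hT1
  have hB0 : 0 < B := by linarith
  set Y := terminalExcess μ σ B W T ω with hY
  set Z := expSup (2 * σ) T (fun n ↦ bridge W T (denseTime T n) ω) with hZ
  have hs : 0 < √(T : ℝ) := Real.sqrt_pos.2 hT'
  have hs1 : √(T : ℝ) ≤ 1 := Real.sqrt_le_one.2 hT1'
  set A := B * (√T + |Y|) * Real.exp |Y| with hA
  have hA0 : 0 < A := by positivity
  rcases eq_or_ne Z ∞ with hZtop | hZtop
  · rw [hZtop, ENNReal.mul_top (by simpa using hA0)]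
    exact le_top
  have hZt (t : ℝ≥0) (ht : t ≤ T) :
      Real.exp (2 * σ * (|bridge W T t ω| / √T)) ≤ Z.toReal := by
    rw [← ENNReal.ofReal_le_iff_le_toReal hZtop]
    refine le_of_forall_denseTime_le
      (f := fun t ↦ ENNReal.ofReal (Real.exp (2 * σ * (|bridge W T t ω| / √T)))) ?_ (fun n ↦ ?_) ht
    · refine ENNReal.continuous_ofReal.comp ?_
      unfold bridge
      fun_prop
    · exact le_iSup (fun n ↦ ENNReal.ofReal
        (Real.exp (2 * σ * (|bridge W T (denseTime T n) ω| / √T)))) n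
  have hdev (t : Set.Icc (0 : ℝ≥0) T) :
      |X t ω - B ^ ((t : ℝ) / (T : ℝ))| ≤ A * Z.toReal := by
    obtain ⟨t, ht⟩ := t
    set u := |bridge W T t ω| / √T with hu
    have hu0 : 0 ≤ u := by positivity
    have hfrac : (t : ℝ) / T ≤ 1 := by
      rw [div_le_one hT']; exact ht.2
    have hfrac0 : 0 ≤ (t : ℝ) / T := by positivity
    have hR : |σ * bridge W T t ω + t / T * (Real.log B + Y) - Real.log B * (t / T)| ≤
        σ * (√T * u) + |Y| := by
      have e : σ * bridge W T t ω + t / T * (Real.log B + Y) - Real.log B * (t / T) =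
          σ * bridge W T t ω + t / T * Y := by ring
      rw [e]
      refine (abs_add_le _ _).trans ?_
      rw [abs_mul, abs_mul, abs_of_pos hσ, abs_of_nonneg hfrac0, hu, mul_div_cancel₀ _ hs.ne']
      gcongr
      exact mul_le_of_le_one_left (abs_nonneg _) hfrac
    have hpow : B ^ ((t : ℝ) / T) ≤ B := by
      calc B ^ ((t : ℝ) / T) ≤ B ^ (1 : ℝ) := Real.rpow_le_rpow_of_exponent_le hB.le hfrac
        _ = B := Real.rpow_one B
    set R := |σ * bridge W T t ω + t / T * (Real.log B + Y) - Real.log B * (t / T)|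
    calc |X t ω - B ^ ((t : ℝ) / (T : ℝ))|
        ≤ B ^ ((t : ℝ) / T) * (R * Real.exp R) := by
          rw [hX, gbm_eq_exp_bridge μ σ B W hT, Real.rpow_def_of_pos hB0]
          exact abs_exp_sub_exp_le _ _
      _ ≤ B * ((σ * (√T * u) + |Y|) * Real.exp (σ * u + |Y|)) := by
          have h1 : σ * (√T * u) ≤ σ * u := by
            gcongr
            exact mul_le_of_le_one_left hu0 hs1
          gcongr
          linarith
      _ ≤ B * (((√T + |Y|) * Real.exp (σ * u)) * Real.exp (σ * u + |Y|)) := by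
          gcongr
          have h1 : σ * u ≤ Real.exp (σ * u) := by linarith [Real.add_one_le_exp (σ * u)]
          have h2 : 1 ≤ Real.exp (σ * u) := Real.one_le_exp (by positivity)
          nlinarith [mul_le_mul_of_nonneg_left h1 hs.le,
            mul_le_mul_of_nonneg_left h2 (abs_nonneg Y)]
      _ = A * Real.exp (2 * σ * u) := by
          rw [hA, Real.exp_add, show 2 * σ * u = σ * u + σ * u by ring, Real.exp_add]
          ring
      _ ≤ A * Z.toReal := by
          gcongr
          exact hZt t ht.2
  have : Nonempty (Set.Icc (0 : ℝ≥0) T) := ⟨0, le_rfl, zero_le⟩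
  calc ENNReal.ofReal (supDeviation X B T ω) ≤ ENNReal.ofReal (A * Z.toReal) :=
        ENNReal.ofReal_le_ofReal (ciSup_le hdev)
    _ = _ := by rw [ENNReal.ofReal_mul hA0.le, ENNReal.ofReal_toReal hZtop]

end Path

/-! ### The conditional expectation -/

section Main

variable {Ω : Type*} {mΩ : MeasurableSpace Ω} {P : Measure Ω} {W X : ℝ≥0 → Ω → ℝ} {μ σ B : ℝ}
  {T : ℝ≥0}

lemma hasLaw_terminalExcess (hW : IsPreBrownianReal W P) :
    HasLaw (terminalExcess μ σ B W T)
      (gaussianReal (-(Real.log B - (μ - σ ^ 2 / 2) * T)) (NNReal.mk (σ ^ 2) (sq_nonneg σ) * T))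
      P := by
  have h := gaussianReal_add_const (gaussianReal_const_mul (hW.hasLaw_eval T) σ)
    ((μ - σ ^ 2 / 2) * T - Real.log B)
  have e : σ * 0 + ((μ - σ ^ 2 / 2) * T - Real.log B) =
      -(Real.log B - (μ - σ ^ 2 / 2) * T) := by ring
  rw [e] at h
  exact h

/-- The expected deviation on the event of hitting the level. -/
lemma setLIntegral_supDeviation_le [IsProbabilityMeasure P] (hW : IsBrownianReal W P)
    (hWm : ∀ t, Measurable (W t)) (hX : ∀ᵐ ω ∂P, ∀ t, X t ω = gbm μ σ W t ω)
    (hhit : NullMeasurableSet (hitEvent X B T) P) (hσ : 0 < σ) (hB : 1 < B) (hT : 0 < T)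
    (hT1 : T ≤ 1) (hTσ : 8 * (σ ^ 2 * T) ≤ Real.log B)
    (hTν : |μ - σ ^ 2 / 2| * T ≤ 1 / 8 * Real.log B) :
    ∫⁻ ω in hitEvent X B T, ENNReal.ofReal (supDeviation X B T ω) ∂P ≤
      expMomentConst (4 * (2 * σ)) ^ (1 / 4 : ℝ) *
      (ENNReal.ofReal (B * (1 + 8 * σ ^ 2 / Real.log B) * (16 * σ ^ 2 / Real.log B)) *
        ENNReal.ofReal (gaussianPDFReal (-(Real.log B - (μ - σ ^ 2 / 2) * T))
          (NNReal.mk (σ ^ 2) (sq_nonneg σ) * T) 0 * T * √T)) := by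
  set b := Real.log B with hb
  have hb0 : 0 < b := Real.log_pos hB
  have hB0 : 0 < B := by linarith
  set q := denseTime T with hq
  set Y := terminalExcess μ σ B W T with hY
  set β : Ω → ℕ → ℝ := fun ω n ↦ bridge W T (q n) ω with hβ
  have hqT : ∀ n, q n ≤ T := denseTime_le T
  have hYm : Measurable Y := ((hWm T).const_mul σ).add_const _
  have hβm : Measurable β := measurable_pi_lambda _ fun n ↦ measurable_bridge hWm T (q n)
  have hind : IndepFun β Y P := by
    have h := (hW.indepFun_bridge hT hqT).comp (φ := id)
      (ψ := fun x ↦ σ * x + ((μ - σ ^ 2 / 2) * T - Real.log B)) measurable_id (by fun_prop)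
    exact h
  let G : (ℕ → ℝ) × ℝ → ℝ≥0∞ := fun p ↦
    ENNReal.ofReal (B * (√T + |p.2|) * Real.exp |p.2|) *
      (expSup (2 * σ) T p.1 * (reachSet σ b T q p.2).indicator 1 p.1)
  have hGm : Measurable G := by
    have h1 : Measurable fun p : (ℕ → ℝ) × ℝ ↦
        (reachSet σ b T q p.2).indicator (1 : (ℕ → ℝ) → ℝ≥0∞) p.1 := by
      have : (fun p : (ℕ → ℝ) × ℝ ↦ (reachSet σ b T q p.2).indicator
          (1 : (ℕ → ℝ) → ℝ≥0∞) p.1) =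
          {p : (ℕ → ℝ) × ℝ | p.1 ∈ reachSet σ b T q p.2}.indicator 1 := by
        ext p
        simp [Set.indicator]
      rw [this]
      exact measurable_one.indicator (measurableSet_reachSet σ b T q)
    have h2 : Measurable fun p : (ℕ → ℝ) × ℝ ↦
        ENNReal.ofReal (B * (√T + |p.2|) * Real.exp |p.2|) := by fun_prop
    exact h2.mul (((measurable_expSup _ T).comp measurable_fst).mul h1)
  have hlaw : HasLaw Y _ P := hasLaw_terminalExcess (μ := μ) (σ := σ) (B := B) (T := T)
    hW.toIsPreBrownianReal
  set m := b - (μ - σ ^ 2 / 2) * T with hm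
  set v : ℝ≥0 := NNReal.mk (σ ^ 2) (sq_nonneg σ) * T with hv
  have hνT : |(μ - σ ^ 2 / 2) * T| ≤ 1 / 8 * b := by
    rwa [abs_mul, abs_of_nonneg T.coe_nonneg]
  obtain ⟨hν1, hν2⟩ := abs_le.1 hνT
  calc ∫⁻ ω in hitEvent X B T, ENNReal.ofReal (supDeviation X B T ω) ∂P
      ≤ ∫⁻ ω, G (β ω, Y ω) ∂P := by
        rw [← lintegral_indicator₀ hhit]
        refine lintegral_mono_ae ?_
        filter_upwards [hX, hW.cont] with ω h1 h2
        by_cases hω : ω ∈ hitEvent X B T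
        · rw [Set.indicator_of_mem hω]
          refine (ofReal_supDeviation_le hσ hB hT hT1 h2 h1).trans_eq ?_
          have hmem := mem_reachSet_of_mem_hitEvent hB0 hT h2 h1 hω
          simp only [G]
          rw [Set.indicator_of_mem hmem]
          simp [hY, hβ, hq]
        · rw [Set.indicator_of_notMem hω]
          exact zero_le
    _ = ∫⁻ p, G p ∂(P.map fun ω ↦ (β ω, Y ω)) :=
        (lintegral_map hGm (hβm.prodMk hYm)).symm
    _ = ∫⁻ y, ∫⁻ w, G (w, y) ∂(P.map β) ∂(gaussianReal (-m) v) := by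
        have := Measure.isProbabilityMeasure_map hβm.aemeasurable (μ := P)
        rw [(indepFun_iff_map_prod_eq_prod_map_map hβm.aemeasurable hYm.aemeasurable).1 hind,
          hlaw.map_eq, lintegral_prod_symm' _ hGm]
    _ ≤ ∫⁻ y, expMomentConst (4 * (2 * σ)) ^ (1 / 4 : ℝ) *
        (ENNReal.ofReal (B * (√T + |y|) * Real.exp |y|) *
        ENNReal.ofReal (Real.exp (3 / 2 * b * min y 0 / (σ ^ 2 * T)))) ∂(gaussianReal (-m) v) := by
        refine lintegral_mono fun y ↦ ?_
        rw [lintegral_map (f := fun w ↦ G (w, y))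
          (hGm.comp (measurable_id.prodMk measurable_const)) hβm]
        simp only [G]
        rw [lintegral_const_mul' _ _ ENNReal.ofReal_ne_top, mul_left_comm]
        gcongr
        exact hW.lintegral_expSup_reachSet_le hWm hT hqT hσ b y (by positivity)
    _ ≤ _ := by
        rw [lintegral_const_mul _ (by fun_prop)]
        gcongr
        exact lintegral_terminal_le hσ hb0 hB0.le hT hT1 (by simp [hv]) hTσ (by linarith)
          (by linarith)

lemma ofReal_mul_le_measure_hitEvent [IsProbabilityMeasure P] (hW : IsBrownianReal W P)
    (hX : ∀ᵐ ω ∂P, ∀ t, X t ω = gbm μ σ W t ω) (hσ : 0 < σ) (hB : 1 < B) (hT : 0 < T)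
    (hT1 : T ≤ 1) (hTν : |μ - σ ^ 2 / 2| * T ≤ 1 / 8 * Real.log B) :
    ENNReal.ofReal (Real.exp (-((9 / 4 * Real.log B + 1) / (2 * σ ^ 2)))) *
      ENNReal.ofReal (gaussianPDFReal (-(Real.log B - (μ - σ ^ 2 / 2) * T))
          (NNReal.mk (σ ^ 2) (sq_nonneg σ) * T) 0 * T) ≤ P (hitEvent X B T) := by
  have hb0 : 0 < Real.log B := Real.log_pos hB
  have hνT : |(μ - σ ^ 2 / 2) * T| ≤ 1 / 8 * Real.log B := by
    rwa [abs_mul, abs_of_nonneg T.coe_nonneg]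
  obtain ⟨hν1, hν2⟩ := abs_le.1 hνT
  have hlaw := hasLaw_terminalExcess (μ := μ) (σ := σ) (B := B) (T := T) hW.toIsPreBrownianReal
  refine (ofReal_mul_le_gaussianReal_Ici hσ hb0 hT hT1 (by simp) (by linarith)).trans ?_
  rw [← hlaw.map_eq, Measure.map_apply_of_aemeasurable hlaw.aemeasurable measurableSet_Ici]
  refine measure_mono_ae ?_
  filter_upwards [hX, hW.cont] with ω h1 h2 h3
  exact mem_hitEvent_of_terminalExcess_nonneg (by linarith) hT h2 h1 h3

end Main

theorem theorem1 (μ σ B : ℝ) (hμ : 0 < μ) (hσ : 0 < σ) (hB : 1 < B) :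
    ∃ C : ℝ, 0 < C ∧ ∃ T₀ : ℝ≥0, 0 < T₀ ∧
      ∀ (Ω : Type*) (mΩ : MeasurableSpace Ω) (P : Measure Ω) (_ : IsProbabilityMeasure P)
        (𝓕 : Filtration ℝ≥0 mΩ) (W X : ℝ≥0 → Ω → ℝ),
        IsBrownianWrt 𝓕 W P → IsGeometricBrownianMotion 𝓕 W P μ σ X →
        ∀ T : ℝ≥0, 0 < T → T < T₀ →
          0 < P (hitEvent X B T) ∧
          Integrable (supDeviation X B T) (ProbabilityTheory.cond P (hitEvent X B T)) ∧
          ∫ ω, supDeviation X B T ω ∂(ProbabilityTheory.cond P (hitEvent X B T))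
            ≤ C * Real.sqrt T := by
  have hb0 : 0 < Real.log B := Real.log_pos hB
  set b := Real.log B with hb
  set K : ℝ≥0∞ := expMomentConst (4 * (2 * σ)) ^ (1 / 4 : ℝ) with hK
  have hKtop : K ≠ ∞ :=
    ENNReal.rpow_ne_top_of_nonneg (by norm_num) (expMomentConst_ne_top _)
  set a : ℝ := B * (1 + 8 * σ ^ 2 / b) * (16 * σ ^ 2 / b) with ha
  have ha0 : 0 < a := by positivity
  set c : ℝ := Real.exp (-((9 / 4 * b + 1) / (2 * σ ^ 2))) with hc
  have hc0 : 0 < c := Real.exp_pos _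
  set ν := |μ - σ ^ 2 / 2| with hν
  have hν0 : 0 ≤ ν := abs_nonneg _
  let T₀ : ℝ := min 1 (b / (8 * (σ ^ 2 + ν)))
  have hT₀ : 0 < T₀ := by positivity
  refine ⟨K.toReal * a / c + 1, by positivity, T₀.toNNReal, Real.toNNReal_pos.2 hT₀, ?_⟩
  intro Ω mΩ P hP 𝓕 W X hW hX T hT hTT₀
  have hT' : (0 : ℝ) < T := hT
  have hTT₀' : (T : ℝ) < T₀ := by
    rwa [← NNReal.coe_lt_coe, Real.coe_toNNReal _ hT₀.le] at hTT₀
  have hT1 : T ≤ 1 := by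
    have : (T : ℝ) ≤ 1 := hTT₀'.le.trans (min_le_left _ _)
    exact_mod_cast this
  have hTb : 8 * (σ ^ 2 + ν) * T ≤ b := by
    have h1 : (T : ℝ) ≤ b / (8 * (σ ^ 2 + ν)) := hTT₀'.le.trans (min_le_right _ _)
    rw [le_div_iff₀ (by positivity)] at h1
    linarith
  have hTσ : 8 * (σ ^ 2 * T) ≤ b := by nlinarith [mul_nonneg hν0 hT'.le]
  have hTν : ν * T ≤ 1 / 8 * b := by nlinarith [mul_nonneg (sq_nonneg σ) hT'.le]
  have hWm t : Measurable (W t) := (hW.adapted t).mono (𝓕.le t) le_rfl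
  have hXm t : Measurable (X t) := (hX.adapted t).mono (𝓕.le t) le_rfl
  have hXg := hX.ae_eq_gbm hW
  have hhit : NullMeasurableSet (hitEvent X B T) P :=
    nullMeasurableSet_le aemeasurable_const (aemeasurable_iSup_Icc hXm hX.cont T)
  have hdevm : AEMeasurable (supDeviation X B T) P := by
    refine aemeasurable_iSup_Icc (Z := fun t ω ↦ |X t ω - B ^ ((t : ℝ) / (T : ℝ))|)
      (fun t ↦ ((hXm t).sub_const _).abs) ?_ T
    filter_upwards [hX.cont] with ω hω
    refine (hω.sub ?_).abs
    exact Continuous.rpow continuous_const (by fun_prop) fun _ ↦ Or.inl (by positivity)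
  have hdev0 ω : 0 ≤ supDeviation X B T ω := Real.iSup_nonneg fun _ ↦ abs_nonneg _
  have hnum := setLIntegral_supDeviation_le hW.isBrownian hWm hXg hhit hσ hB hT hT1 hTσ hTν
  have hden := ofReal_mul_le_measure_hitEvent hW.isBrownian hXg hσ hB hT hT1 hTν
  set p := gaussianPDFReal (-(Real.log B - (μ - σ ^ 2 / 2) * T))
    (NNReal.mk (σ ^ 2) (sq_nonneg σ) * T) 0 with hp
  have hp0 : 0 < p := by
    refine gaussianPDFReal_pos _ _ _ fun h ↦ ?_
    have := congrArg NNReal.toReal h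
    simp at this
    rcases this with h | h
    · exact hσ.ne' h
    · exact hT.ne' h
  have hPpos : 0 < P (hitEvent X B T) := by
    refine lt_of_lt_of_le ?_ hden
    rw [← ENNReal.ofReal_mul hc0.le]
    exact ENNReal.ofReal_pos.2 (by positivity)
  have hlint : ∫⁻ ω, ENNReal.ofReal (supDeviation X B T ω) ∂(cond P (hitEvent X B T)) ≤
      ENNReal.ofReal (K.toReal * a / c * √T) := by
    rw [ProbabilityTheory.cond, lintegral_smul_measure, smul_eq_mul,
      ENNReal.inv_mul_le_iff hPpos.ne' (measure_ne_top _ _)]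
    calc _ ≤ K * (ENNReal.ofReal a * ENNReal.ofReal (p * T * √T)) := hnum
      _ = ENNReal.ofReal c * ENNReal.ofReal (p * T) * ENNReal.ofReal (K.toReal * a / c * √T) := by
          rw [← ENNReal.ofReal_toReal hKtop, ENNReal.toReal_ofReal ENNReal.toReal_nonneg,
            ← ENNReal.ofReal_mul ha0.le, ← ENNReal.ofReal_mul ENNReal.toReal_nonneg,
            ← ENNReal.ofReal_mul hc0.le, ← ENNReal.ofReal_mul (by positivity)]
          congr 1
          field_simp
      _ ≤ _ := by gcongr
  have hdevc : AEStronglyMeasurable (supDeviation X B T) (cond P (hitEvent X B T)) :=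
    (hdevm.restrict.smul_measure _).aestronglyMeasurable
  refine ⟨hPpos, ?_, ?_⟩
  · rw [← lintegral_ofReal_ne_top_iff_integrable hdevc (Eventually.of_forall hdev0)]
    exact ne_top_of_le_ne_top ENNReal.ofReal_ne_top hlint
  · rw [integral_eq_lintegral_of_nonneg_ae (Eventually.of_forall hdev0) hdevc]
    refine (ENNReal.toReal_le_of_le_ofReal (by positivity) hlint).trans ?_
    gcongr
    linarith
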